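/- **Theorem.** Let $k$ be a field. For a finite family $C=(c_1,\dots,c_s)$ of nonzero elements of $\mathbb{N}^n$ let $I_C$ be the kernel of $k[x_1,\dots,x_s]\to k[t_1,\dots,t_n]$, $x_i\mapsto t^{c_i}$, and let $k[C]=k[x_1,\dots,x_s]/I_C$, graded by giving $x_i$ the weight $|c_i|$ (the sum of the coordinates of $c_i$). Let $A=(a_1,\dots,a_p)$ and $B=(b_1,\dots,b_q)$ be such families, let $C=A\sqcup B$ be the concatenated family, $R_A=k[x_1,\dots,x_p]$, $R_B=k[y_1,\dots,y_q]$ and $R=k[x_1,\dots,x_p,y_1,\dots,y_q]$, so that $I_A\subset R_A$, $I_B\subset R_B$ and $I_C\subset R$. Suppose that $\langle C\rangle$ is obtained by gluing $\langle A\rangle$ and $\langle B\rangle$, that is, there is a binomial $\rho=\prod_i x_i^{\alpha_i}-\prod_j y_j^{\beta_j}\in R$ such that $I_C$ is minimally generated by the union of a minimal generating set of $I_A$, a minimal generating set of $I_B$, and $\{\rho\}$. Let $F_A$ and $F_B$ be minimal graded free resolutions of $k[A]$ over $R_A$ and of $k[B]$ over $R_B$, and let $F_A\otimes F_B$ denote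 the tensor product over $R$ of their extensions of scalars to $R$. Then: 1. $F_A\otimes F_B$ is a minimal graded free resolution of $R/(I_AR+I_BR)$ over $R$. 2. The mapping cone of the multiplication by $\rho$, $F_A\otimes F_B(-\deg\rho)\xrightarrow{\ \rho\ }F_A\otimes F_B$, is a minimal graded free resolution of $k[C]=R/I_C$ over $R$. 3. Let $\beta_i(A)$, $\beta_i(B)$, $\beta_i(C)$ be the Betti numbers of $k[A]$, $k[B]$, $k[C]$ over $R_A$, $R_B$, $R$ (the rank of the $i$-th module in any minimal graded free resolution, and $0$ for $i<0$). For all $i\ge 0$, $$\beta_i(C)=\sum_{i'=0}^{i}\beta_{i'}(A)\,[\beta_{i-i'}(B)+\beta_{i-i'-1}(B)]=\sum_{i'=0}^{i}\beta_{i'}(B)\,[\beta_{i-i'}(A)+\beta_{i-i'-1}(A)].$$ 4. The Cohen–Macaulay type of $k[C]$ is the product of the Cohen–Macaulay types of $k[A]$ and $k[B]$, where the Cohen–Macaulay type means the last nonzero Betti number, whose index is the projective dimension (the rings are not assumed to be Cohen–Macaulay). -/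

import Mathlib

noncomputable section

/-- A chain complex (in homological degrees `≥ 0`) of finitely generated free graded `R`-modules,
given by homogeneous bases: the basis element `e_j`, for `j : ι`, has homological degree `hdeg j`
and internal degree `deg j` (so it spans a copy of `R(-deg j)`), the free module in homological
degree `n` has the basis `{e_j | hdeg j = n}`, and the differential is given by
`d e_j = ∑ i, (diff j i) e_i`. -/
structure FreeComplex (R : Type*) [CommRing R] where
  /-- the index set of the homogeneous bases of all the free modules -/
  ι : Type
  /-- homological degrees of the basis elements -/
  hdeg : ι → ℕ
  /-- internal degrees of the basis elements -/
  deg : ι → ℕ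
  /-- the differential on basis elements -/
  diff : ι → ι →₀ R
  finite_hdeg : ∀ n, {j | hdeg j = n}.Finite
  hdeg_of_diff_ne_zero : ∀ j i, diff j i ≠ 0 → hdeg i + 1 = hdeg j
  diff_diff : ∀ j, Finsupp.linearCombination R diff (diff j) = 0

namespace FreeComplex

section General

variable {R : Type*} [CommRing R]

/-- The differential, as an endomorphism of the direct sum of all the free modules. -/
def d (F : FreeComplex R) : (F.ι →₀ R) →ₗ[R] (F.ι →₀ R) :=
  Finsupp.linearCombination R F.diff

/-- The free module in homological degree `n`. -/
def part (F : FreeComplex R) (n : ℕ) : Submodule R (F.ι →₀ R) :=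
  Finsupp.supported R R {j | F.hdeg j = n}

/-- The rank of the free module in homological degree `i` (zero for negative `i`). -/
def rank (F : FreeComplex R) (i : ℤ) : ℕ :=
  {j : F.ι | (F.hdeg j : ℤ) = i}.ncard

/-- Extension of scalars of a complex of free modules along a ring homomorphism. -/
def baseChange {S : Type*} [CommRing S] (F : FreeComplex R) (f : R →+* S) : FreeComplex S where
  ι := F.ι
  hdeg := F.hdeg
  deg := F.deg
  diff j := (F.diff j).mapRange f (map_zero f)
  finite_hdeg := F.finite_hdeg
  hdeg_of_diff_ne_zero j i h := by
    refine F.hdeg_of_diff_ne_zero j i fun h0 => h ?_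
    simp [h0]
  diff_diff j := by
    have key : ∀ x : F.ι →₀ R,
        Finsupp.linearCombination S (fun j => (F.diff j).mapRange f (map_zero f))
          (x.mapRange f (map_zero f)) =
        (Finsupp.linearCombination R F.diff x).mapRange f (map_zero f) := by
      intro x
      induction x using Finsupp.induction_linear with
      | zero => simp
      | add x y hx hy =>
        rw [Finsupp.mapRange_add (map_add f), map_add, hx, hy, map_add,
          Finsupp.mapRange_add (map_add f)]
      | single i r =>
        ext l
        simp
    rw [key, F.diff_diff]
    simp

/-- The bilinear map `(x, y) ↦ x ⊗ y` for two free modules with bases `(e_i)` and `(e_j)`, the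
tensor product being identified with the free module on the basis `(e_i ⊗ e_j)`. -/
def tmul (R : Type*) [CommRing R] (ι κ : Type) :
    (ι →₀ R) →ₗ[R] (κ →₀ R) →ₗ[R] (ι × κ →₀ R) :=
  Finsupp.linearCombination R fun i => Finsupp.lmapDomain R R (Prod.mk i)

theorem tmul_single_single (ι κ : Type) (i : ι) (j : κ) (r s : R) :
    tmul R ι κ (Finsupp.single i r) (Finsupp.single j s) = Finsupp.single (i, j) (r * s) := by
  simp [tmul]

theorem tmul_apply (ι κ : Type) (x : ι →₀ R) (y : κ →₀ R) (i : ι) (j : κ) :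
    tmul R ι κ x y (i, j) = x i * y j := by
  classical
  induction x using Finsupp.induction_linear with
  | zero => simp
  | add x x' hx hx' => simp [hx, hx', add_mul]
  | single i' r =>
    induction y using Finsupp.induction_linear with
    | zero => simp
    | add y y' hy hy' => rw [map_add, Finsupp.add_apply, hy, hy']; simp [mul_add]
    | single j' s =>
      rw [tmul_single_single]
      simp only [Finsupp.single_apply, Prod.mk.injEq]
      split_ifs <;> simp_all

/-- The differential of the tensor product of two complexes,
`d (e_i ⊗ e_j) = d e_i ⊗ e_j + (-1)^|e_i| e_i ⊗ d e_j`. -/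
def tensorDiff (F G : FreeComplex R) (x : F.ι × G.ι) : F.ι × G.ι →₀ R :=
  tmul R F.ι G.ι (F.diff x.1) (Finsupp.single x.2 1) +
    (-1 : R) ^ F.hdeg x.1 • tmul R F.ι G.ι (Finsupp.single x.1 1) (G.diff x.2)

theorem linearCombination_tensorDiff_tmul (F G : FreeComplex R) (n : ℕ) (x : F.ι →₀ R)
    (hx : ∀ i, x i ≠ 0 → F.hdeg i = n) (y : G.ι →₀ R) :
    Finsupp.linearCombination R (tensorDiff F G) (tmul R F.ι G.ι x y) =
      tmul R F.ι G.ι (F.d x) y + (-1 : R) ^ n • tmul R F.ι G.ι x (G.d y) := by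
  classical
  have h1 : ∀ i, F.hdeg i = n → ∀ (r : R) (y : G.ι →₀ R),
      Finsupp.linearCombination R (tensorDiff F G) (tmul R F.ι G.ι (Finsupp.single i r) y) =
      tmul R F.ι G.ι (F.d (Finsupp.single i r)) y +
        (-1 : R) ^ n • tmul R F.ι G.ι (Finsupp.single i r) (G.d y) := by
    intro i hi r y
    induction y using Finsupp.induction_linear with
    | zero => simp
    | add y y' hy hy' => simp only [map_add, hy, hy', smul_add]; abel
    | single j s =>
      rw [tmul_single_single]
      ext ⟨l, m⟩
      simp only [d, tensorDiff, hi, Finsupp.linearCombination_single, Finsupp.add_apply,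
        Finsupp.smul_apply, tmul_apply, smul_eq_mul, Finsupp.single_apply]
      split_ifs <;> ring
  have h2 : x = ∑ i ∈ x.support, Finsupp.single i (x i) := (Finsupp.sum_single x).symm
  rw [h2]
  simp only [map_sum, LinearMap.sum_apply, Finset.smul_sum]
  rw [← Finset.sum_add_distrib]
  refine Finset.sum_congr rfl fun i hi => h1 i (hx i (by simpa using hi)) _ _

/-- The tensor product (over `R`) of two complexes of free modules. -/
def tensor (F G : FreeComplex R) : FreeComplex R where
  ι := F.ι × G.ι
  hdeg x := F.hdeg x.1 + G.hdeg x.2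
  deg x := F.deg x.1 + G.deg x.2
  diff := tensorDiff F G
  finite_hdeg n := by
    refine Set.Finite.subset
      ((Set.finite_Iic n).biUnion fun p _ =>
        (Set.finite_Iic n).biUnion fun q _ => (F.finite_hdeg p).prod (G.finite_hdeg q)) ?_
    rintro ⟨i, j⟩ h
    simp only [Set.mem_ofPred_eq] at h
    simp only [Set.mem_iUnion, Set.mem_prod, Set.mem_ofPred_eq, Set.mem_Iic]
    exact ⟨F.hdeg i, by omega, G.hdeg j, by omega, rfl, rfl⟩
  hdeg_of_diff_ne_zero := by
    classical
    rintro ⟨i, j⟩ ⟨i', j'⟩ h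
    simp only [tensorDiff, Finsupp.add_apply, Finsupp.smul_apply, tmul_apply,
      Finsupp.single_apply, smul_eq_mul] at h
    by_cases h1 : F.diff i i' * (if j = j' then 1 else 0) = 0
    · rw [h1, zero_add] at h
      have h2 := right_ne_zero_of_mul h
      have h3 := right_ne_zero_of_mul h2
      have h4 := G.hdeg_of_diff_ne_zero _ _ h3
      have h5 : i = i' := by
        by_contra hne
        exact h2 (by simp [hne])
      subst h5
      simp only
      omega
    · have h3 := F.hdeg_of_diff_ne_zero _ _ (left_ne_zero_of_mul h1)
      have h5 : j = j' := by
        by_contra hne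
        exact h1 (by simp [hne])
      subst h5
      simp only
      omega
  diff_diff := by
    classical
    rintro ⟨i, j⟩
    have hF : F.d (F.diff i) = 0 := F.diff_diff i
    have hG : G.d (G.diff j) = 0 := G.diff_diff j
    have hs : G.d (Finsupp.single j 1) = G.diff j := by simp [d]
    have ht : F.d (Finsupp.single i 1) = F.diff i := by simp [d]
    have e2 := linearCombination_tensorDiff_tmul F G (F.hdeg i) (Finsupp.single i 1)
      (fun l hl => by
        rw [Finsupp.single_apply] at hl
        split_ifs at hl with h
        · rw [h]
        · exact absurd rfl hl) (G.diff j)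
    have e1 := linearCombination_tensorDiff_tmul F G (F.hdeg i - 1) (F.diff i)
      (fun l hl => by have := F.hdeg_of_diff_ne_zero i l hl; omega) (Finsupp.single j 1)
    simp only [tensorDiff, map_add, map_smul, e1, e2, hF, hG, hs, ht, map_zero,
      LinearMap.zero_apply, zero_add, add_zero, smul_zero]
    by_cases h0 : F.diff i = 0
    · simp [h0]
    · obtain ⟨l, hl⟩ := Finsupp.ne_iff.mp h0
      have := F.hdeg_of_diff_ne_zero i l hl
      rw [← this, Nat.add_sub_cancel, pow_succ, ← add_smul]
      simp

/-- The differential of the mapping cone of the multiplication by `r` on `F`. -/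
def coneDiff (F : FreeComplex R) (r : R) : F.ι ⊕ F.ι → F.ι ⊕ F.ι →₀ R
  | Sum.inl j => Finsupp.lmapDomain R R Sum.inl (F.diff j)
  | Sum.inr j => Finsupp.single (Sum.inl j) r - Finsupp.lmapDomain R R Sum.inr (F.diff j)

theorem lmapDomain_inl_apply_inr (ι : Type) (x : ι →₀ R) (i : ι) :
    Finsupp.lmapDomain R R (Sum.inl : ι → ι ⊕ ι) x (Sum.inr i) = 0 := by
  rw [Finsupp.lmapDomain_apply]
  exact Finsupp.mapDomain_of_notMem_range x _ (by simp)

theorem lmapDomain_inr_apply_inl (ι : Type) (x : ι →₀ R) (i : ι) :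
    Finsupp.lmapDomain R R (Sum.inr : ι → ι ⊕ ι) x (Sum.inl i) = 0 := by
  rw [Finsupp.lmapDomain_apply]
  exact Finsupp.mapDomain_of_notMem_range x _ (by simp)

theorem lmapDomain_inl_apply_inl (ι : Type) (x : ι →₀ R) (i : ι) :
    Finsupp.lmapDomain R R (Sum.inl : ι → ι ⊕ ι) x (Sum.inl i) = x i := by
  rw [Finsupp.lmapDomain_apply]
  exact Finsupp.mapDomain_apply Sum.inl_injective x i

theorem lmapDomain_inr_apply_inr (ι : Type) (x : ι →₀ R) (i : ι) :
    Finsupp.lmapDomain R R (Sum.inr : ι → ι ⊕ ι) x (Sum.inr i) = x i := by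
  rw [Finsupp.lmapDomain_apply]
  exact Finsupp.mapDomain_apply Sum.inr_injective x i

theorem linearCombination_coneDiff_inl (F : FreeComplex R) (r : R) (x : F.ι →₀ R) :
    Finsupp.linearCombination R (coneDiff F r) (Finsupp.lmapDomain R R Sum.inl x) =
      Finsupp.lmapDomain R R Sum.inl (F.d x) := by
  induction x using Finsupp.induction_linear with
  | zero => simp
  | add x y hx hy => simp only [map_add, hx, hy]
  | single i s => simp [coneDiff, d]

theorem linearCombination_coneDiff_inr (F : FreeComplex R) (r : R) (x : F.ι →₀ R) :
    Finsupp.linearCombination R (coneDiff F r) (Finsupp.lmapDomain R R Sum.inr x) =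
      r • Finsupp.lmapDomain R R Sum.inl x - Finsupp.lmapDomain R R Sum.inr (F.d x) := by
  induction x using Finsupp.induction_linear with
  | zero => simp
  | add x y hx hy => simp only [map_add, hx, hy, smul_add]; abel
  | single i s => simp [coneDiff, d, smul_sub, mul_comm]

/-- The mapping cone of the multiplication `F(-e) → F` by an element `r` (of internal degree `e`):
its module in homological degree `n` is `F_n ⊕ F_{n-1}(-e)`, and its differential is
`(x, y) ↦ (d x + r y, - d y)`. -/
def cone (F : FreeComplex R) (r : R) (e : ℕ) : FreeComplex R where
  ι := F.ι ⊕ F.ι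
  hdeg := Sum.elim F.hdeg fun j => F.hdeg j + 1
  deg := Sum.elim F.deg fun j => F.deg j + e
  diff := coneDiff F r
  finite_hdeg n := by
    refine Set.Finite.subset (((F.finite_hdeg n).image Sum.inl).union
      ((F.finite_hdeg (n - 1)).image Sum.inr)) ?_
    rintro (j | j) h
    · exact Or.inl ⟨j, h, rfl⟩
    · refine Or.inr ⟨j, ?_, rfl⟩
      simp only [Set.mem_ofPred_eq, Sum.elim_inr] at h ⊢
      omega
  hdeg_of_diff_ne_zero := by
    classical
    rintro (j | j) (i | i) h
    · simp only [coneDiff, lmapDomain_inl_apply_inl] at h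
      simpa using F.hdeg_of_diff_ne_zero j i h
    · simp only [coneDiff, lmapDomain_inl_apply_inr] at h
      exact absurd rfl h
    · simp only [coneDiff, Finsupp.sub_apply, lmapDomain_inr_apply_inl, sub_zero,
        Finsupp.single_apply] at h
      split_ifs at h with h1
      · simp [Sum.inl_injective h1]
      · exact absurd rfl h
    · simp only [coneDiff, Finsupp.sub_apply, lmapDomain_inr_apply_inr] at h
      have h2 : F.diff j i ≠ 0 := by
        intro h0
        simp [h0] at h
      simpa using F.hdeg_of_diff_ne_zero j i h2
  diff_diff := by
    rintro (j | j)
    · have hF : F.d (F.diff j) = 0 := F.diff_diff j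
      simp only [coneDiff]
      rw [linearCombination_coneDiff_inl, hF, map_zero]
    · have hF : F.d (F.diff j) = 0 := F.diff_diff j
      simp only [coneDiff]
      rw [map_sub, linearCombination_coneDiff_inr, hF, map_zero, sub_zero,
        Finsupp.linearCombination_single]
      simp [coneDiff]

end General

variable {k : Type*} [Field k] {σ : Type*}

/-- `F` is a minimal graded free resolution of the graded module `R/I`, where the polynomial ring
`R = k[x_s | s ∈ σ]` is graded by giving the weight `w s` to the variable `x_s`. -/
structure IsMinimalGradedFreeResolution (w : σ → ℕ) (I : Ideal (MvPolynomial σ k))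
    (F : FreeComplex (MvPolynomial σ k)) : Prop where
  /-- the differential is homogeneous of degree zero -/
  graded : ∀ j i, F.diff j i ≠ 0 →
    ∃ m, F.deg i + m = F.deg j ∧ MvPolynomial.IsWeightedHomogeneous w (F.diff j i) m
  /-- the image of the differential lies in `(x_s | s ∈ σ) F` -/
  minimal : ∀ j i, F.diff j i ∈ Ideal.span (Set.range (MvPolynomial.X (R := k) (σ := σ)))
  /-- the complex is exact in positive homological degrees -/
  exact_pos : ∀ n, ∀ x ∈ F.part (n + 1), F.d x = 0 → ∃ y ∈ F.part (n + 2), F.d y = x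
  /-- there is a homogeneous surjection of degree zero from `F_0` onto `R/I`, whose kernel is the
  image of `F_1` -/
  exact_zero : ∃ ε : (F.ι →₀ MvPolynomial σ k) →ₗ[MvPolynomial σ k] (MvPolynomial σ k ⧸ I),
    (∀ j, F.hdeg j = 0 → ∃ f, MvPolynomial.IsWeightedHomogeneous w f (F.deg j) ∧
      ε (Finsupp.single j 1) = Ideal.Quotient.mk I f) ∧
    (∀ z, ∃ x ∈ F.part 0, ε x = z) ∧
    ∀ x ∈ F.part 0, ε x = 0 ↔ ∃ y ∈ F.part 1, F.d y = x

end FreeComplex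

section Invariants

variable {k : Type*} [Field k] {σ : Type*}

/-- `β` is the sequence of Betti numbers of the graded module `R/I`: a minimal graded free
resolution of `R/I` exists, and in every one of them the `i`-th module has rank `β i`
(with `β i = 0` for negative `i`). -/
def HasBettiNumbers (w : σ → ℕ) (I : Ideal (MvPolynomial σ k)) (β : ℤ → ℕ) : Prop :=
  (∃ F, FreeComplex.IsMinimalGradedFreeResolution w I F) ∧
    ∀ F, FreeComplex.IsMinimalGradedFreeResolution w I F → ∀ i, F.rank i = β i

/-- `t` is the Cohen-Macaulay type of `R/I`, that is, its last nonzero Betti number (the one whose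
index is the projective dimension of `R/I`). -/
def HasCohenMacaulayType (w : σ → ℕ) (I : Ideal (MvPolynomial σ k)) (t : ℕ) : Prop :=
  ∃ β : ℤ → ℕ, HasBettiNumbers w I β ∧ ∃ r : ℤ, β r = t ∧ t ≠ 0 ∧ ∀ i, r < i → β i = 0

end Invariants

section Semigroups

variable {n : ℕ} {σ : Type*}

/-- The ideal `I_C` of the affine semigroup generated by a family `c` of elements of `ℕⁿ`:
the kernel of the algebra homomorphism `k[x_s | s ∈ σ] → k[t_1, …, t_n]`, `x_s ↦ t ^ c s`. -/
def semigroupIdeal (k : Type*) [Field k] (c : σ → Fin n →₀ ℕ) : Ideal (MvPolynomial σ k) :=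
  RingHom.ker (MvPolynomial.aeval fun s => MvPolynomial.monomial (c s) (1 : k))

/-- The weight `|c s|` (the sum of the coordinates) of the variable `x_s`. -/
def semigroupWeight (c : σ → Fin n →₀ ℕ) (s : σ) : ℕ := (c s).degree

/-- `S` is a minimal generating set of the ideal `I`. -/
def MinimallyGenerates {R : Type*} [CommRing R] (S : Set R) (I : Ideal R) : Prop :=
  Ideal.span S = I ∧ ∀ T, T ⊂ S → Ideal.span T ≠ I

/-- The inclusion `R_A = k[x] → R = k[x, y]`. -/
def inclA (k : Type*) [Field k] (p q : ℕ) :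
    MvPolynomial (Fin p) k →+* MvPolynomial (Fin p ⊕ Fin q) k :=
  (MvPolynomial.rename Sum.inl :
    MvPolynomial (Fin p) k →ₐ[k] MvPolynomial (Fin p ⊕ Fin q) k).toRingHom

/-- The inclusion `R_B = k[y] → R = k[x, y]`. -/
def inclB (k : Type*) [Field k] (p q : ℕ) :
    MvPolynomial (Fin q) k →+* MvPolynomial (Fin p ⊕ Fin q) k :=
  (MvPolynomial.rename Sum.inr :
    MvPolynomial (Fin q) k →ₐ[k] MvPolynomial (Fin p ⊕ Fin q) k).toRingHom

/-- The binomial `ρ = ∏ x_i ^ α_i - ∏ y_j ^ β_j`. -/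
def gluingBinomial (k : Type*) [Field k] {p q : ℕ} (α : Fin p →₀ ℕ) (β : Fin q →₀ ℕ) :
    MvPolynomial (Fin p ⊕ Fin q) k :=
  inclA k p q (MvPolynomial.monomial α 1) - inclB k p q (MvPolynomial.monomial β 1)

/-- The semigroup generated by `C = A ⊔ B` is obtained by gluing the semigroups generated by `A`
and by `B`, with the gluing binomial `ρ = x ^ α - y ^ β`: the ideal `I_C` is minimally generated by
minimal generators of `I_A`, minimal generators of `I_B`, and `ρ`. -/
def IsGluing (k : Type*) [Field k] {p q : ℕ} (a : Fin p → Fin n →₀ ℕ) (b : Fin q → Fin n →₀ ℕ)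
    (α : Fin p →₀ ℕ) (β : Fin q →₀ ℕ) : Prop :=
  ∃ (S : Set (MvPolynomial (Fin p) k)) (T : Set (MvPolynomial (Fin q) k)),
    MinimallyGenerates S (semigroupIdeal k a) ∧ MinimallyGenerates T (semigroupIdeal k b) ∧
    MinimallyGenerates (inclA k p q '' S ∪ inclB k p q '' T ∪ {gluingBinomial k α β})
      (semigroupIdeal k (Sum.elim a b))

end Semigroups

end

/-! Acyclicity of the tensor product needs no Tor computation. As a vector space, the tensor product
over `R` of the extended resolutions is `F_A ⊗_k F_B` (`tensorEquiv`, `tensorEquiv_d`). Over the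
field `k` each resolution contracts `k`-linearly onto a section of its augmentation
(`exists_contraction`), and two contractions combine to one of the tensor product
(`tensor_homotopy`). What is left is `R_A/I_A ⊗_k R_B/I_B`, which injects into `R/(I_A R + I_B R)`
(`quotTensor_injective`).

For the cone, the point is that `ρ` is a nonzerodivisor modulo `I_A R + I_B R`. That ideal is the
kernel of `x_i ↦ t^(a_i)`, `y_j ↦ t'^(b_j)` with two disjoint sets of variables
(`mem_sumIdeal_semigroupIdeal`). The target is a domain, and `ρ` goes to a monomial in `t` minus a
monomial in `t'`, which is nonzero because `α ≠ 0` and no `a_i` is zero. Hence the cone resolves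
`R/(I_A R + I_B R + (ρ)) = R/I_C`. It is graded because `ρ ∈ I_C` forces both monomials of `ρ` to
have the same degree. It is minimal because `α` and `β` are nonzero, which comes from `ρ ≠ 0`, that
is, from `ρ` being part of a minimal generating set (`IsGluing.ne_zero`).

Betti numbers are well defined because a comparison map out of a minimal resolution is split
injective modulo the variables (`IsAugmented.rank_le`); the formulas then count basis elements of a
cone over a tensor product. For the type, Hilbert's syzygy theorem (`ExactAbove.hdeg_le`) provides
last nonzero modules, in degrees `a` and `b` say, and only their product reaches degree `a + b + 1`
of the cone.

Throughout, a complex is treated as one module with an endomorphism `d`; homological degrees are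
recovered by the projections `proj`. -/

noncomputable section

namespace FreeComplex

/-! ### Homological degrees: the modules of a complex and the projections onto them -/

section Basic

variable {R : Type*} [CommRing R] (F : FreeComplex R)

theorem d_single (j : F.ι) (r : R) : F.d (Finsupp.single j r) = r • F.diff j := by
  simp [d]

theorem d_d (x : F.ι →₀ R) : F.d (F.d x) = 0 := by
  induction x using Finsupp.induction_linear with
  | zero => simp
  | add x y hx hy => simp [hx, hy]
  | single j r =>
    rw [d_single, map_smul]
    have h : F.d (F.diff j) = 0 := F.diff_diff j
    rw [h, smul_zero]

theorem mem_part {n : ℕ} {x : F.ι →₀ R} : x ∈ F.part n ↔ ∀ j, x j ≠ 0 → F.hdeg j = n := by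
  rw [part, Finsupp.mem_supported]
  simp [Set.subset_def]

theorem single_mem_part (j : F.ι) (r : R) : Finsupp.single j r ∈ F.part (F.hdeg j) :=
  Finsupp.single_mem_supported R r (by simp)

/-- Two linear maps which agree on the basis elements of homological degree `n` agree on the
`n`-th module of the complex. -/
theorem eqOn_part {M : Type*} [AddCommGroup M] [Module R M] {f g : (F.ι →₀ R) →ₗ[R] M} {n : ℕ}
    (h : ∀ j, F.hdeg j = n → f (Finsupp.single j 1) = g (Finsupp.single j 1))
    {x : F.ι →₀ R} (hx : x ∈ F.part n) : f x = g x := by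
  rw [← Finsupp.sum_single x, Finsupp.sum, map_sum, map_sum]
  refine Finset.sum_congr rfl fun j hj => ?_
  rw [← mul_one (x j), ← smul_eq_mul, ← Finsupp.smul_single, map_smul, map_smul,
    h j (F.mem_part.1 hx j (by simpa using hj))]

/-- A linear map sends the `n`-th module of the complex into a submodule as soon as it does so
with the basis elements of homological degree `n`. -/
theorem map_mem_of_mem_part {M : Type*} [AddCommGroup M] [Module R M] {f : (F.ι →₀ R) →ₗ[R] M}
    {n : ℕ} {P : Submodule R M} (h : ∀ j, F.hdeg j = n → f (Finsupp.single j 1) ∈ P)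
    {x : F.ι →₀ R} (hx : x ∈ F.part n) : f x ∈ P := by
  rw [← Finsupp.sum_single x, Finsupp.sum, map_sum]
  refine Submodule.sum_mem _ fun j hj => ?_
  rw [← mul_one (x j), ← smul_eq_mul, ← Finsupp.smul_single, map_smul]
  exact P.smul_mem _ (h j (F.mem_part.1 hx j (by simpa using hj)))

theorem diff_mem_part {n : ℕ} (j : F.ι) (hj : F.hdeg j = n + 1) : F.diff j ∈ F.part n :=
  F.mem_part.2 fun i hi => by have := F.hdeg_of_diff_ne_zero j i hi; omega

theorem diff_eq_zero_of_hdeg (j : F.ι) (hj : F.hdeg j = 0) : F.diff j = 0 := by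
  ext i
  by_contra h
  have := F.hdeg_of_diff_ne_zero j i h
  omega

theorem d_mem_part {n : ℕ} {x : F.ι →₀ R} (hx : x ∈ F.part (n + 1)) : F.d x ∈ F.part n :=
  F.map_mem_of_mem_part (fun j hj => by rw [d_single, one_smul]; exact F.diff_mem_part j hj) hx

theorem d_eq_zero_of_mem_part_zero {x : F.ι →₀ R} (hx : x ∈ F.part 0) : F.d x = 0 := by
  have := F.eqOn_part (f := F.d) (g := 0) (n := 0)
    (fun j hj => by rw [d_single, F.diff_eq_zero_of_hdeg j hj]; simp) hx
  simpa using this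

open Classical in
/-- The projection of the direct sum of all the modules of the complex onto the sum of those whose
homological degrees satisfy a condition. -/
def proj (P : ℕ → Prop) : (F.ι →₀ R) →ₗ[R] (F.ι →₀ R) :=
  Finsupp.linearCombination R fun j => if P (F.hdeg j) then Finsupp.single j 1 else 0

theorem proj_single_of_pos {P : ℕ → Prop} {j : F.ι} (h : P (F.hdeg j)) (r : R) :
    F.proj P (Finsupp.single j r) = Finsupp.single j r := by
  simp [proj, h]

theorem proj_single_of_neg {P : ℕ → Prop} {j : F.ι} (h : ¬ P (F.hdeg j)) (r : R) :
    F.proj P (Finsupp.single j r) = 0 := by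
  simp [proj, h]

theorem proj_of_forall {P : ℕ → Prop} {x : F.ι →₀ R} (h : ∀ j, x j ≠ 0 → P (F.hdeg j)) :
    F.proj P x = x := by
  conv_rhs => rw [← Finsupp.sum_single x]
  conv_lhs => rw [← Finsupp.sum_single x]
  rw [Finsupp.sum, map_sum]
  exact Finset.sum_congr rfl fun j hj => F.proj_single_of_pos (h j (by simpa using hj)) _

theorem proj_eq_zero_of_forall {P : ℕ → Prop} {x : F.ι →₀ R}
    (h : ∀ j, x j ≠ 0 → ¬ P (F.hdeg j)) : F.proj P x = 0 := by
  rw [← Finsupp.sum_single x, Finsupp.sum, map_sum]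
  exact Finset.sum_eq_zero fun j hj => F.proj_single_of_neg (h j (by simpa using hj)) _

theorem proj_of_mem_part {n : ℕ} {x : F.ι →₀ R} (hx : x ∈ F.part n) : F.proj (· = n) x = x :=
  F.proj_of_forall (F.mem_part.1 hx)

theorem proj_mem_part (n : ℕ) (x : F.ι →₀ R) : F.proj (· = n) x ∈ F.part n := by
  induction x using Finsupp.induction_linear with
  | zero => simp
  | add x y hx hy => rw [map_add]; exact add_mem hx hy
  | single j r =>
    by_cases h : F.hdeg j = n
    · rw [F.proj_single_of_pos h]
      exact h ▸ F.single_mem_part j r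
    · rw [F.proj_single_of_neg h]
      exact zero_mem _

/-- The differential lowers the homological degree by one. Besides single degrees, this serves for
parities, where `P` and `Q` are each other's negation. -/
theorem proj_d {P Q : ℕ → Prop} (hPQ : ∀ n, P n ↔ Q (n + 1)) (x : F.ι →₀ R) :
    F.proj P (F.d x) = F.d (F.proj Q x) := by
  induction x using Finsupp.induction_linear with
  | zero => simp
  | add x y hx hy => simp only [map_add, hx, hy]
  | single j r =>
    rw [d_single, map_smul]
    by_cases h : Q (F.hdeg j)
    · rw [F.proj_single_of_pos h, d_single, F.proj_of_forall fun i hi => by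
        rwa [hPQ, F.hdeg_of_diff_ne_zero j i hi]]
    · rw [F.proj_single_of_neg h, F.proj_eq_zero_of_forall fun i hi => by
        rwa [hPQ, F.hdeg_of_diff_ne_zero j i hi]]
      simp

theorem proj_d_succ (n : ℕ) (x : F.ι →₀ R) :
    F.proj (· = n) (F.d x) = F.d (F.proj (· = n + 1) x) :=
  F.proj_d (by simp) x

theorem sum_proj (x : F.ι →₀ R) :
    ∑ n ∈ x.support.image F.hdeg, F.proj (· = n) x = x := by
  have h : ∀ n, F.proj (· = n) x =
      ∑ j ∈ x.support, if F.hdeg j = n then Finsupp.single j (x j) else 0 := by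
    intro n
    conv_lhs => rw [← Finsupp.sum_single x, Finsupp.sum, map_sum]
    refine Finset.sum_congr rfl fun j _ => ?_
    split_ifs with h
    · exact F.proj_single_of_pos h _
    · exact F.proj_single_of_neg h _
  simp only [h]
  rw [Finset.sum_comm]
  conv_rhs => rw [← Finsupp.sum_single x, Finsupp.sum]
  refine Finset.sum_congr rfl fun j hj => ?_
  rw [Finset.sum_ite_eq, if_pos (Finset.mem_image_of_mem _ hj)]

end Basic

/-! ### Resolutions as augmented total complexes -/

section Augmented

variable {R : Type*} [CommRing R]

/-- The map `ε`, concentrated in homological degree zero, makes `F` a resolution of `R/I`. -/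
structure IsAugmented (F : FreeComplex R) (I : Ideal R) (ε : (F.ι →₀ R) →ₗ[R] (R ⧸ I)) : Prop where
  eq_zero : ∀ j, F.hdeg j ≠ 0 → ε (Finsupp.single j 1) = 0
  surjective : Function.Surjective ε
  comp_d : ∀ x, ε (F.d x) = 0
  exact : ∀ x, F.d x = 0 → ε x = 0 → ∃ y, F.d y = x

theorem IsAugmented.apply_proj {F : FreeComplex R} {I : Ideal R} {ε : (F.ι →₀ R) →ₗ[R] (R ⧸ I)}
    (h : F.IsAugmented I ε) (x : F.ι →₀ R) : ε (F.proj (· = 0) x) = ε x := by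
  induction x using Finsupp.induction_linear with
  | zero => simp
  | add x y hx hy => simp only [map_add, hx, hy]
  | single j r =>
    by_cases hj : F.hdeg j = 0
    · rw [F.proj_single_of_pos hj]
    · rw [F.proj_single_of_neg hj, ← mul_one r, ← smul_eq_mul, ← Finsupp.smul_single, map_smul,
        h.eq_zero j hj, smul_zero, map_zero]

theorem IsAugmented.apply_of_mem_part_succ {F : FreeComplex R} {I : Ideal R}
    {ε : (F.ι →₀ R) →ₗ[R] (R ⧸ I)} (h : F.IsAugmented I ε) {n : ℕ} {x : F.ι →₀ R}
    (hx : x ∈ F.part (n + 1)) : ε x = 0 :=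
  F.eqOn_part (f := ε) (g := 0) (fun j hj => h.eq_zero j (by omega)) hx

variable {k : Type*} [Field k] {σ : Type*}

/-- Exactness of the total complex gives exactness in each degree: a preimage of a homogeneous cycle
may be replaced by its component of the right degree. -/
theorem IsMinimalGradedFreeResolution.of_isAugmented {w : σ → ℕ} {I : Ideal (MvPolynomial σ k)}
    {F : FreeComplex (MvPolynomial σ k)}
    (graded : ∀ j i, F.diff j i ≠ 0 →
      ∃ m, F.deg i + m = F.deg j ∧ MvPolynomial.IsWeightedHomogeneous w (F.diff j i) m)
    (minimal : ∀ j i, F.diff j i ∈ Ideal.span (Set.range (MvPolynomial.X (R := k) (σ := σ))))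
    {ε : (F.ι →₀ MvPolynomial σ k) →ₗ[MvPolynomial σ k] (MvPolynomial σ k ⧸ I)}
    (hε : F.IsAugmented I ε)
    (homogeneous : ∀ j, F.hdeg j = 0 → ∃ f, MvPolynomial.IsWeightedHomogeneous w f (F.deg j) ∧
      ε (Finsupp.single j 1) = Ideal.Quotient.mk I f) :
    F.IsMinimalGradedFreeResolution w I where
  graded := graded
  minimal := minimal
  exact_pos n x hx hdx := by
    obtain ⟨y, rfl⟩ := hε.exact x hdx (hε.apply_of_mem_part_succ hx)
    exact ⟨_, F.proj_mem_part (n + 2) y, by rw [← proj_d_succ, F.proj_of_mem_part hx]⟩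
  exact_zero := by
    refine ⟨ε, homogeneous, fun z => ?_, fun x hx => ⟨fun h => ?_, ?_⟩⟩
    · obtain ⟨x, rfl⟩ := hε.surjective z
      exact ⟨_, F.proj_mem_part 0 x, hε.apply_proj x⟩
    · obtain ⟨y, rfl⟩ := hε.exact x (F.d_eq_zero_of_mem_part_zero hx) h
      exact ⟨_, F.proj_mem_part 1 y, by rw [← proj_d_succ, F.proj_of_mem_part hx]⟩
    · rintro ⟨y, _, rfl⟩
      exact hε.comp_d y

theorem IsMinimalGradedFreeResolution.exists_isAugmented {w : σ → ℕ}
    {I : Ideal (MvPolynomial σ k)} {F : FreeComplex (MvPolynomial σ k)}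
    (hF : F.IsMinimalGradedFreeResolution w I) :
    ∃ ε : (F.ι →₀ MvPolynomial σ k) →ₗ[MvPolynomial σ k] (MvPolynomial σ k ⧸ I),
      F.IsAugmented I ε ∧
      ∀ j, F.hdeg j = 0 → ∃ f, MvPolynomial.IsWeightedHomogeneous w f (F.deg j) ∧
        ε (Finsupp.single j 1) = Ideal.Quotient.mk I f := by
  obtain ⟨ε, homogeneous, surj, exact⟩ := hF.exact_zero
  -- The given map is constrained in homological degree zero only, so it is first made to vanish
  -- elsewhere.
  refine ⟨ε ∘ₗ F.proj (· = 0), ⟨fun j hj => ?_, fun z => ?_, fun x => ?_, fun x hx hεx => ?_⟩,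
    fun j hj => ?_⟩
  · simp [F.proj_single_of_neg (P := (· = 0)) hj]
  · obtain ⟨x, hx, rfl⟩ := surj z
    exact ⟨x, by simp [F.proj_of_mem_part hx]⟩
  · rw [LinearMap.comp_apply, proj_d_succ]
    exact (exact _ (F.d_mem_part (F.proj_mem_part 1 x))).2 ⟨_, F.proj_mem_part 1 x, rfl⟩
  · suffices h : x ∈ LinearMap.range F.d from h
    rw [← F.sum_proj x]
    refine Submodule.sum_mem _ fun n _ => ?_
    cases n with
    | zero =>
      obtain ⟨y, -, hy⟩ := (exact _ (F.proj_mem_part 0 x)).1 hεx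
      exact ⟨y, hy⟩
    | succ n =>
      obtain ⟨y, -, hy⟩ := hF.exact_pos n _ (F.proj_mem_part (n + 1) x)
        (by rw [← proj_d_succ, hx, map_zero])
      exact ⟨y, hy⟩
  · obtain ⟨f, hf, h⟩ := homogeneous j hj
    exact ⟨f, hf, by simp [F.proj_single_of_pos (P := (· = 0)) hj, h]⟩

end Augmented

/-! ### The mapping cone of a nonzerodivisor -/

section Cone

variable {R : Type*} [CommRing R]

/-- The augmentation of the mapping cone of the multiplication by `r`. -/
def coneAug (F : FreeComplex R) {I J : Ideal R} (h : I ≤ J) (ε : (F.ι →₀ R) →ₗ[R] (R ⧸ I)) :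
    (F.ι ⊕ F.ι →₀ R) →ₗ[R] (R ⧸ J) :=
  Finsupp.linearCombination R
    (Sum.elim (fun j => Submodule.factor h (ε (Finsupp.single j 1))) fun _ => 0)

theorem coneAug_inl (F : FreeComplex R) {I J : Ideal R} (h : I ≤ J)
    (ε : (F.ι →₀ R) →ₗ[R] (R ⧸ I)) (x : F.ι →₀ R) :
    coneAug F h ε (Finsupp.lmapDomain R R Sum.inl x) = Submodule.factor h (ε x) := by
  induction x using Finsupp.induction_linear with
  | zero => simp
  | add x y hx hy => simp only [map_add, hx, hy]
  | single j r =>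
    conv_rhs => rw [← mul_one r, ← smul_eq_mul, ← Finsupp.smul_single, map_smul, map_smul]
    simp [coneAug]

theorem coneAug_inr (F : FreeComplex R) {I J : Ideal R} (h : I ≤ J)
    (ε : (F.ι →₀ R) →ₗ[R] (R ⧸ I)) (x : F.ι →₀ R) :
    coneAug F h ε (Finsupp.lmapDomain R R Sum.inr x) = 0 := by
  induction x using Finsupp.induction_linear with
  | zero => simp
  | add x y hx hy => simp only [map_add, hx, hy, add_zero]
  | single j r => simp [coneAug]

theorem exists_eq_inl_add_inr {ι : Type} (z : ι ⊕ ι →₀ R) :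
    ∃ x y : ι →₀ R, z = Finsupp.lmapDomain R R Sum.inl x + Finsupp.lmapDomain R R Sum.inr y := by
  induction z using Finsupp.induction_linear with
  | zero => exact ⟨0, 0, by simp⟩
  | add z z' hz hz' =>
    obtain ⟨x, y, rfl⟩ := hz
    obtain ⟨x', y', rfl⟩ := hz'
    exact ⟨x + x', y + y', by simp only [map_add]; abel⟩
  | single j r =>
    rcases j with j | j
    · exact ⟨Finsupp.single j r, 0, by simp⟩
    · exact ⟨0, Finsupp.single j r, by simp⟩

theorem linearCombination_coneDiff (F : FreeComplex R) (r : R) (x y : F.ι →₀ R) :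
    Finsupp.linearCombination R (coneDiff F r)
        (Finsupp.lmapDomain R R Sum.inl x + Finsupp.lmapDomain R R Sum.inr y) =
      Finsupp.lmapDomain R R Sum.inl (F.d x + r • y) - Finsupp.lmapDomain R R Sum.inr (F.d y) := by
  rw [map_add, linearCombination_coneDiff_inl, linearCombination_coneDiff_inr, map_add, map_smul]
  abel

theorem inl_add_inr_eq_zero {ι : Type} {x y : ι →₀ R}
    (h : Finsupp.lmapDomain R R (Sum.inl : ι → ι ⊕ ι) x -
      Finsupp.lmapDomain R R (Sum.inr : ι → ι ⊕ ι) y = 0) : x = 0 ∧ y = 0 := by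
  constructor
  · ext i
    have := DFunLike.congr_fun h (Sum.inl i)
    rwa [Finsupp.sub_apply, lmapDomain_inl_apply_inl, lmapDomain_inr_apply_inl, sub_zero] at this
  · ext i
    have := DFunLike.congr_fun h (Sum.inr i)
    rwa [Finsupp.sub_apply, lmapDomain_inl_apply_inr, lmapDomain_inr_apply_inr, zero_sub,
      Finsupp.zero_apply, neg_eq_zero] at this

theorem IsAugmented.coneAug_comp {F : FreeComplex R} {I : Ideal R}
    {ε : (F.ι →₀ R) →ₗ[R] (R ⧸ I)} (h : F.IsAugmented I ε) (r : R) (z : F.ι ⊕ F.ι →₀ R) :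
    coneAug F (le_sup_left : I ≤ I ⊔ Ideal.span {r}) ε
      (Finsupp.linearCombination R (coneDiff F r) z) = 0 := by
  obtain ⟨x, y, rfl⟩ := exists_eq_inl_add_inr z
  rw [linearCombination_coneDiff, map_sub, coneAug_inl, coneAug_inr, map_add, h.comp_d, zero_add,
    sub_zero, map_smul]
  obtain ⟨s, hs⟩ := Ideal.Quotient.mk_surjective (ε y)
  rw [← hs]
  change Ideal.Quotient.mk _ (r * s) = 0
  exact Ideal.Quotient.eq_zero_iff_mem.2
    (Ideal.mul_mem_right _ _ (Ideal.mem_sup_right (Ideal.mem_span_singleton_self r)))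

/-- A cycle `(x, y)` satisfies `d x + r y = 0` and `d y = 0`. Augmenting the first equation gives `r
• ε y = 0`, so `ε y = 0` by regularity and `y = d w`. Then `x + r w` is a cycle whose augmentation
is a multiple of `r`; once a suitable `r v` is subtracted it is a boundary `d u`, and `(u, v - w)`
is the required preimage. -/
theorem IsAugmented.coneAug_exact {F : FreeComplex R} {I : Ideal R}
    {ε : (F.ι →₀ R) →ₗ[R] (R ⧸ I)} (h : F.IsAugmented I ε) (r : R)
    (hr : ∀ z : R ⧸ I, r • z = 0 → z = 0) (z : F.ι ⊕ F.ι →₀ R)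
    (hz : Finsupp.linearCombination R (coneDiff F r) z = 0)
    (hεz : coneAug F (le_sup_left : I ≤ I ⊔ Ideal.span {r}) ε z = 0) :
    ∃ y, Finsupp.linearCombination R (coneDiff F r) y = z := by
  obtain ⟨x, y, rfl⟩ := exists_eq_inl_add_inr z
  rw [linearCombination_coneDiff] at hz
  obtain ⟨hxy, hy⟩ := inl_add_inr_eq_zero hz
  rw [map_add, coneAug_inl, coneAug_inr, add_zero] at hεz
  have hεy : ε y = 0 := by
    apply hr
    have := congrArg ε hxy
    rwa [map_add, h.comp_d, zero_add, map_smul, map_zero] at this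
  obtain ⟨w, rfl⟩ := h.exact y hy hεy
  obtain ⟨v, hdv, hv⟩ : ∃ v, F.d v = 0 ∧ ε (x + r • w) = r • ε v := by
    obtain ⟨s, hs⟩ := Ideal.Quotient.mk_surjective (ε x)
    rw [← hs] at hεz
    change Ideal.Quotient.mk _ s = 0 at hεz
    rw [Ideal.Quotient.eq_zero_iff_mem, Submodule.mem_sup] at hεz
    obtain ⟨a, ha, b, hb, rfl⟩ := hεz
    obtain ⟨c, rfl⟩ := Ideal.mem_span_singleton'.1 hb
    obtain ⟨v, hv⟩ := h.surjective (Ideal.Quotient.mk I c)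
    -- The summand `w` accounts for the term `r • ε w` in the augmentation of `x + r • w`.
    -- Projecting to degree zero turns `v + w` into a cycle without changing its augmentation.
    refine ⟨F.proj (· = 0) (v + w), F.d_eq_zero_of_mem_part_zero (F.proj_mem_part 0 _), ?_⟩
    rw [h.apply_proj, map_add, map_add, hv, map_smul, smul_add, ← hs, map_add,
      Ideal.Quotient.eq_zero_iff_mem.2 ha, zero_add, mul_comm]
    rfl
  obtain ⟨u, hu⟩ := h.exact (x + r • w - r • v)
    (by rw [map_sub, map_add, map_smul, map_smul, hdv, smul_zero, sub_zero, hxy])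
    (by rw [map_sub, hv, map_smul, sub_self])
  refine ⟨Finsupp.lmapDomain R R Sum.inl u + Finsupp.lmapDomain R R Sum.inr (v - w), ?_⟩
  rw [linearCombination_coneDiff, hu, map_sub F.d, hdv, zero_sub, map_neg, sub_neg_eq_add]
  congr 2
  rw [smul_sub]
  abel

/-- If `F` is a resolution of `R/I` and `r` is a nonzerodivisor modulo `I`, then the mapping cone
of the multiplication by `r` is a resolution of `R/(I + (r))`. -/
theorem IsAugmented.cone {F : FreeComplex R} {I : Ideal R} {ε : (F.ι →₀ R) →ₗ[R] (R ⧸ I)}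
    (h : F.IsAugmented I ε) (r : R) (e : ℕ) (hr : ∀ z : R ⧸ I, r • z = 0 → z = 0) :
    (F.cone r e).IsAugmented (I ⊔ Ideal.span {r})
      (coneAug F (le_sup_left : I ≤ I ⊔ Ideal.span {r}) ε) where
  eq_zero := by
    rintro (j | j) hj
    · have hj : F.hdeg j ≠ 0 := hj
      refine (Finsupp.linearCombination_single R _ _).trans ?_
      simp [h.eq_zero j hj]
    · refine (Finsupp.linearCombination_single R _ _).trans ?_
      simp
  surjective z := by
    obtain ⟨w, rfl⟩ := Submodule.factor_surjective (le_sup_left : I ≤ I ⊔ Ideal.span {r}) z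
    obtain ⟨x, rfl⟩ := h.surjective w
    exact ⟨_, coneAug_inl F _ ε x⟩
  comp_d := h.coneAug_comp r
  exact := h.coneAug_exact r hr

end Cone

end FreeComplex

end

noncomputable section

namespace FreeComplex

open TensorProduct

/-! ### Contractions of resolutions, linear over the ground field -/

section Contraction

/-- Over a field, an exact augmented complex is contractible onto the target of its augmentation. -/
theorem exists_contraction {k X Q : Type*} [Field k] [AddCommGroup X] [Module k X]
    [AddCommGroup Q] [Module k Q] {d : X →ₗ[k] X} {ε : X →ₗ[k] Q} {s : Q →ₗ[k] X}
    (hd : ∀ x, d (d x) = 0) (hεd : ∀ x, ε (d x) = 0) (hεs : ∀ q, ε (s q) = q)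
    (hds : ∀ q, d (s q) = 0) (exact : ∀ x, d x = 0 → ε x = 0 → ∃ y, d y = x) :
    ∃ h : X →ₗ[k] X, ∀ x, d (h x) + h (d x) = x - s (ε x) := by
  obtain ⟨u, hu⟩ := d.rangeRestrict.exists_rightInverse_of_surjective d.range_rangeRestrict
  have hdu : ∀ v, d (u v) = v := fun v => by
    have := LinearMap.congr_fun hu v
    simpa using congrArg Subtype.val this
  -- The correction puts `v` into the kernel of `ε`, and `v` still splits `d` because `d` vanishes
  -- on the image of `s`.
  let v : LinearMap.range d →ₗ[k] X := u - s ∘ₗ ε ∘ₗ u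
  have hdv : ∀ y, d (v y) = y := fun y => by simp [v, hdu, hds]
  have hεv : ∀ y, ε (v y) = 0 := fun y => by simp [v, hεs]
  -- `x - v (d x) - s (ε x)` is a cycle of augmentation zero, hence a boundary by exactness. As `π`
  -- fixes boundaries, `v ∘ₗ π` is the contraction.
  let π : X →ₗ[k] LinearMap.range d :=
    (LinearMap.id - v ∘ₗ d.rangeRestrict - s ∘ₗ ε).codRestrict _ fun x => by
      apply exact
      · have := hdv (d.rangeRestrict x)
        simp [this, hds]
      · simp [hεv, hεs]
  have hπ : ∀ x, (π x : X) = x - v (d.rangeRestrict x) - s (ε x) := fun x => rfl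
  refine ⟨v ∘ₗ π, fun x => ?_⟩
  have h2 : π (d x) = d.rangeRestrict x := by
    apply Subtype.ext
    have h0 : d.rangeRestrict (d x) = 0 := Subtype.ext (hd x)
    rw [hπ, hεd, h0, map_zero, map_zero, sub_zero, sub_zero]
    rfl
  rw [LinearMap.comp_apply, LinearMap.comp_apply, hdv, hπ, h2]
  abel

variable {R : Type*} [CommRing R]

/-- The involution which multiplies a basis element `e_j` by `(-1) ^ hdeg j`. -/
def sign (F : FreeComplex R) : (F.ι →₀ R) →ₗ[R] (F.ι →₀ R) :=
  Finsupp.linearCombination R fun j => Finsupp.single j ((-1) ^ F.hdeg j)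

theorem sign_eq (F : FreeComplex R) (x : F.ι →₀ R) :
    F.sign x = F.proj Even x - F.proj (fun n => ¬ Even n) x := by
  induction x using Finsupp.induction_linear with
  | zero => simp
  | add x y hx hy => simp only [map_add, hx, hy]; abel
  | single j r =>
    by_cases h : Even (F.hdeg j)
    · rw [F.proj_single_of_pos h, F.proj_single_of_neg (not_not.2 h)]
      simp [sign, h.neg_one_pow]
    · rw [F.proj_single_of_neg h, F.proj_single_of_pos (P := fun n => ¬ Even n) h]
      simp [sign, (Nat.not_even_iff_odd.1 h).neg_one_pow]

theorem proj_even_add (F : FreeComplex R) (x : F.ι →₀ R) :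
    F.proj Even x + F.proj (fun n => ¬ Even n) x = x := by
  induction x using Finsupp.induction_linear with
  | zero => simp
  | add x y hx hy => rw [map_add, map_add, add_add_add_comm, hx, hy]
  | single j r =>
    by_cases h : Even (F.hdeg j)
    · rw [F.proj_single_of_pos h, F.proj_single_of_neg (not_not.2 h), add_zero]
    · rw [F.proj_single_of_neg h, F.proj_single_of_pos (P := fun n => ¬ Even n) h, zero_add]

theorem proj_proj (F : FreeComplex R) (P Q : ℕ → Prop) (x : F.ι →₀ R) :
    F.proj P (F.proj Q x) = F.proj (fun n => P n ∧ Q n) x := by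
  induction x using Finsupp.induction_linear with
  | zero => simp
  | add x y hx hy => simp only [map_add, hx, hy]
  | single j r =>
    by_cases hQ : Q (F.hdeg j)
    · by_cases hP : P (F.hdeg j)
      · rw [F.proj_single_of_pos hQ, F.proj_single_of_pos hP,
          F.proj_single_of_pos (P := fun n => P n ∧ Q n) ⟨hP, hQ⟩]
      · rw [F.proj_single_of_pos hQ, F.proj_single_of_neg hP,
          F.proj_single_of_neg (P := fun n => P n ∧ Q n) fun h => hP h.1]
    · rw [F.proj_single_of_neg hQ, map_zero,
        F.proj_single_of_neg (P := fun n => P n ∧ Q n) fun h => hQ h.2]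

/-- A resolution of `R/I` has a `k`-linear contraction which anticommutes with the sign
involution. -/
theorem IsAugmented.exists_contraction (k : Type*) [Field k] [Algebra k R] {F : FreeComplex R}
    {I : Ideal R} {ε : (F.ι →₀ R) →ₗ[R] (R ⧸ I)} (hF : F.IsAugmented I ε) :
    ∃ (h : (F.ι →₀ R) →ₗ[k] (F.ι →₀ R)) (s : (R ⧸ I) →ₗ[k] (F.ι →₀ R)),
      (∀ x, F.d (h x) + h (F.d x) = x - s (ε x)) ∧ (∀ x, F.sign (h x) + h (F.sign x) = 0) ∧
      (∀ q, F.d (s q) = 0) ∧ (∀ q, F.sign (s q) = s q) ∧ ∀ x, ε (F.sign x) = ε x := by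
  obtain ⟨t, ht⟩ := (ε.restrictScalars k).exists_rightInverse_of_surjective
    (LinearMap.range_eq_top.2 hF.surjective)
  -- Values in degree zero are automatically cycles and are fixed by the sign involution.
  let s : (R ⧸ I) →ₗ[k] (F.ι →₀ R) := (F.proj (· = 0)).restrictScalars k ∘ₗ t
  have hεs : ∀ q, ε (s q) = q := fun q => by
    have := LinearMap.congr_fun ht q
    simp only [s, LinearMap.comp_apply, LinearMap.restrictScalars_apply] at this ⊢
    rw [hF.apply_proj, this]
    rfl
  have hs0 : ∀ q, s q ∈ F.part 0 := fun q => F.proj_mem_part 0 _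
  have hds : ∀ q, F.d (s q) = 0 := fun q => F.d_eq_zero_of_mem_part_zero (hs0 q)
  obtain ⟨h, hh⟩ := FreeComplex.exists_contraction (d := F.d.restrictScalars k)
    (ε := ε.restrictScalars k) (s := s) F.d_d hF.comp_d hεs hds hF.exact
  simp only [LinearMap.restrictScalars_apply] at hh
  -- The sign involution is `e - o`, so the splitting by parity is the only trace of the grading
  -- that the contraction has to respect.
  set e := F.proj Even with he
  set o := F.proj (fun n => ¬ Even n) with ho
  have heo : ∀ x, e x + o x = x := F.proj_even_add
  have hsign : ∀ x, F.sign x = e x - o x := F.sign_eq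
  have hed : ∀ x, e (F.d x) = F.d (o x) := F.proj_d fun n => by simp [Nat.even_add_one]
  have hod : ∀ x, o (F.d x) = F.d (e x) := F.proj_d fun n => by simp [Nat.even_add_one]
  have hee : ∀ x, e (e x) = e x := fun x => by simp [he, F.proj_proj]
  have hoo : ∀ x, o (o x) = o x := fun x => by simp [ho, F.proj_proj]
  have heo' : ∀ x, e (o x) = 0 := fun x => by
    rw [he, ho, F.proj_proj]
    exact F.proj_eq_zero_of_forall (by simp)
  have hoe : ∀ x, o (e x) = 0 := fun x => by
    rw [he, ho, F.proj_proj]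
    exact F.proj_eq_zero_of_forall (by simp)
  have hes : ∀ q, e (s q) = s q := fun q =>
    F.proj_of_forall fun j hj => by rw [F.mem_part.1 (hs0 q) j hj]; exact Even.zero
  have hos : ∀ q, o (s q) = 0 := fun q =>
    F.proj_eq_zero_of_forall fun j hj => by rw [F.mem_part.1 (hs0 q) j hj]; simp
  have hεo : ∀ x, ε (o x) = 0 := fun x => by
    rw [← hF.apply_proj, ho, F.proj_proj, F.proj_eq_zero_of_forall, map_zero]
    rintro j - ⟨h1, h2⟩
    exact h2 (h1 ▸ Even.zero)
  have hεe : ∀ x, ε (e x) = ε x := fun x => by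
    conv_rhs => rw [← heo x, map_add, hεo, add_zero]
  -- Only the parity-reversing components of `h` are kept: such a map anticommutes with the sign. It
  -- remains a contraction, since `d` reverses parity and the identity for `h` can be compared on
  -- even and odd parts.
  refine ⟨o.restrictScalars k ∘ₗ h ∘ₗ e.restrictScalars k +
    e.restrictScalars k ∘ₗ h ∘ₗ o.restrictScalars k, s, fun x => ?_, fun x => ?_, hds,
    fun q => ?_, fun x => ?_⟩
  · have h1 := congrArg e (hh (e x))
    have h2 := congrArg o (hh (o x))
    rw [map_add, map_sub, hεe, hes, hee] at h1
    rw [map_add, map_sub, hεo, map_zero, map_zero, sub_zero, hoo] at h2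
    have h3 := heo x
    simp only [LinearMap.add_apply, LinearMap.comp_apply, LinearMap.restrictScalars_apply, map_add]
    rw [← hed, ← hod, hed x, hod x]
    calc _ = (e (F.d (h (e x))) + e (h (F.d (e x)))) + (o (F.d (h (o x))) + o (h (F.d (o x)))) := by
          abel
      _ = x - s (ε x) := by rw [h1, h2, sub_add_eq_add_sub, h3]
  · simp only [LinearMap.add_apply, LinearMap.comp_apply, LinearMap.restrictScalars_apply, map_add,
      hsign, map_sub, hee, hoo, heo', hoe, map_zero]
    abel
  · rw [hsign, hes, hos, sub_zero]
  · rw [hsign, map_sub, hεe, hεo, sub_zero]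

end Contraction

end FreeComplex

end

/-! ### Contracting a tensor product over the ground field -/

noncomputable section

namespace FreeComplex

open TensorProduct

/-- The endomorphism `d ⊗ 1 + σ ⊗ e` of a tensor product. -/
def tensorEnd {k X Y : Type*} [Field k] [AddCommGroup X] [Module k X] [AddCommGroup Y] [Module k Y]
    (d σ : X →ₗ[k] X) (e : Y →ₗ[k] Y) : X ⊗[k] Y →ₗ[k] X ⊗[k] Y :=
  TensorProduct.map d LinearMap.id + TensorProduct.map σ e

theorem tensorEnd_tmul {k X Y : Type*} [Field k] [AddCommGroup X] [Module k X] [AddCommGroup Y]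
    [Module k Y] (d σ : X →ₗ[k] X) (e : Y →ₗ[k] Y) (x : X) (y : Y) :
    tensorEnd d σ e (x ⊗ₜ y) = d x ⊗ₜ y + σ x ⊗ₜ e y := rfl

/-- The homotopy `h ⊗ 1 + P ⊗ g` contracts a tensor product of complexes. -/
theorem tensor_homotopy {k X Y : Type*} [Field k] [AddCommGroup X] [Module k X]
    [AddCommGroup Y] [Module k Y] {d h P σ : X →ₗ[k] X} {e g Q : Y →ₗ[k] Y}
    (hd : ∀ x, d (h x) + h (d x) = x - P x) (he : ∀ y, e (g y) + g (e y) = y - Q y)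
    (hσ : ∀ x, σ (h x) + h (σ x) = 0) (hdP : ∀ x, d (P x) = 0) (hPd : ∀ x, P (d x) = 0)
    (hσP : ∀ x, σ (P x) = P x) (hPσ : ∀ x, P (σ x) = P x) (w : X ⊗[k] Y) :
    tensorEnd d σ e (tensorEnd h P g w) + tensorEnd h P g (tensorEnd d σ e w) +
      TensorProduct.map P Q w = w := by
  induction w with
  | zero => simp
  | add w w' hw hw' =>
    simp only [map_add] at hw hw' ⊢
    conv_rhs => rw [← hw, ← hw']
    abel
  | tmul x y =>
    simp only [tensorEnd_tmul, map_tmul, map_add, hdP, hPd, hσP, hPσ, zero_tmul]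
    have h1 : d (h x) ⊗ₜ[k] y + h (d x) ⊗ₜ[k] y = x ⊗ₜ y - P x ⊗ₜ y := by
      rw [← add_tmul, hd, sub_tmul]
    have h2 : σ (h x) ⊗ₜ[k] e y + h (σ x) ⊗ₜ[k] e y = 0 := by
      rw [← add_tmul, hσ, zero_tmul]
    have h3 : P x ⊗ₜ[k] e (g y) + P x ⊗ₜ[k] g (e y) = P x ⊗ₜ y - P x ⊗ₜ Q y := by
      rw [← tmul_add, he, tmul_sub]
    -- The mixed terms cancel because `h` anticommutes with `σ`; the others telescope from `x ⊗ y`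
    -- through `P x ⊗ y` to `P x ⊗ Q y`.
    calc _ = (d (h x) ⊗ₜ[k] y + h (d x) ⊗ₜ[k] y) + (σ (h x) ⊗ₜ[k] e y + h (σ x) ⊗ₜ[k] e y) +
          (P x ⊗ₜ[k] e (g y) + P x ⊗ₜ[k] g (e y)) + P x ⊗ₜ[k] Q y := by abel
      _ = _ := by rw [h1, h2, h3]; abel

/-! ### Extension of scalars -/

section BaseChange

variable {R S : Type*} [CommRing R] [CommRing S]

/-- The map from a complex to its extension of scalars. -/
def toBaseChange (F : FreeComplex R) (f : R →+* S) : (F.ι →₀ R) →+ ((F.baseChange f).ι →₀ S) :=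
  Finsupp.mapRange.addMonoidHom f.toAddMonoidHom

theorem toBaseChange_single (F : FreeComplex R) (f : R →+* S) (j : F.ι) (r : R) :
    F.toBaseChange f (Finsupp.single j r) =
      (Finsupp.single j (f r) : (F.baseChange f).ι →₀ S) :=
  Finsupp.mapRange_single (hf := map_zero f)

theorem toBaseChange_apply (F : FreeComplex R) (f : R →+* S) (x : F.ι →₀ R)
    (j : (F.baseChange f).ι) : F.toBaseChange f x j = f (x j) := rfl

theorem toBaseChange_diff (F : FreeComplex R) (f : R →+* S) (j : F.ι) :
    F.toBaseChange f (F.diff j) = (F.baseChange f).diff j := rfl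

theorem toBaseChange_smul (F : FreeComplex R) (f : R →+* S) (r : R) (x : F.ι →₀ R) :
    F.toBaseChange f (r • x) = f r • F.toBaseChange f x :=
  Finsupp.ext fun j => map_mul f r (x j)

theorem d_toBaseChange (F : FreeComplex R) (f : R →+* S) (x : F.ι →₀ R) :
    (F.baseChange f).d (F.toBaseChange f x) = F.toBaseChange f (F.d x) := by
  induction x using Finsupp.induction_linear with
  | zero => simp
  | add x y hx hy => simp only [map_add, hx, hy]
  | single j r =>
    rw [toBaseChange_single, d_single, toBaseChange_smul, toBaseChange_diff]
    exact (F.baseChange f).d_single _ _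

end BaseChange

/-! ### The tensor product over `R` as a tensor product over `k` -/

section Tensor

variable {k : Type*} [Field k] {p q : ℕ}

theorem tensorEquivSum_tmul (f : MvPolynomial (Fin p) k) (g : MvPolynomial (Fin q) k) :
    MvPolynomial.tensorEquivSum k (Fin p) (Fin q) k (f ⊗ₜ g) = inclA k p q f * inclB k p q g := by
  have : (MvPolynomial.tensorEquivSum k (Fin p) (Fin q) k).toAlgHom =
      Algebra.TensorProduct.productMap (MvPolynomial.rename Sum.inl)
        (MvPolynomial.rename Sum.inr) := by
    ext <;> simp
  exact DFunLike.congr_fun this (f ⊗ₜ g)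

variable (FA : FreeComplex (MvPolynomial (Fin p) k)) (FB : FreeComplex (MvPolynomial (Fin q) k))

/-- The tensor product over `R` of the extensions of scalars of two complexes is, as a vector
space, their tensor product over `k`. -/
def tensorEquiv : (FA.ι →₀ MvPolynomial (Fin p) k) ⊗[k] (FB.ι →₀ MvPolynomial (Fin q) k) ≃ₗ[k]
    ((FA.baseChange (inclA k p q)).ι × (FB.baseChange (inclB k p q)).ι →₀
      MvPolynomial (Fin p ⊕ Fin q) k) :=
  (finsuppTensorFinsupp k k _ _ FA.ι FB.ι).trans
    (Finsupp.mapRange.linearEquiv (MvPolynomial.tensorEquivSum k (Fin p) (Fin q) k).toLinearEquiv)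

theorem tensorEquiv_tmul (x : FA.ι →₀ MvPolynomial (Fin p) k)
    (y : FB.ι →₀ MvPolynomial (Fin q) k) :
    tensorEquiv FA FB (x ⊗ₜ y) =
      tmul (MvPolynomial (Fin p ⊕ Fin q) k) _ _ (FA.toBaseChange (inclA k p q) x)
        (FB.toBaseChange (inclB k p q) y) := by
  ext1 ⟨i, j⟩
  rw [tmul_apply, toBaseChange_apply, toBaseChange_apply, ← tensorEquivSum_tmul]
  exact congrArg (MvPolynomial.tensorEquivSum k (Fin p) (Fin q) k)
    (finsuppTensorFinsupp_apply k k _ _ FA.ι FB.ι x y i j)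

/-- This moves the question of exactness from `R` to `k`. The power of `-1` in the tensor
differential depends on a degree, so the first factor is reduced to a multiple of a basis element,
on which `sign` acts by that power. -/
theorem tensorEquiv_d (w : (FA.ι →₀ MvPolynomial (Fin p) k) ⊗[k]
    (FB.ι →₀ MvPolynomial (Fin q) k)) :
    Finsupp.linearCombination (MvPolynomial (Fin p ⊕ Fin q) k)
      (tensorDiff (FA.baseChange (inclA k p q)) (FB.baseChange (inclB k p q)))
      (tensorEquiv FA FB w) =
    tensorEquiv FA FB (tensorEnd (FA.d.restrictScalars k) (FA.sign.restrictScalars k)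
      (FB.d.restrictScalars k) w) := by
  induction w with
  | zero => simp
  | add w w' hw hw' => simp only [map_add, hw, hw']
  | tmul x y =>
    induction x using Finsupp.induction_linear with
    | zero => simp
    | add x x' hx hx' => simp only [add_tmul, map_add, hx, hx']
    | single i r =>
      rw [tensorEquiv_tmul, linearCombination_tensorDiff_tmul _ _ (FA.hdeg i), tensorEnd_tmul,
        map_add, tensorEquiv_tmul, tensorEquiv_tmul, d_toBaseChange,
        d_toBaseChange]
      · congr 1
        have h : FA.sign (Finsupp.single i r) = (-1 : MvPolynomial (Fin p) k) ^ FA.hdeg i •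
            Finsupp.single i r := by simp [sign, mul_comm]
        rw [LinearMap.restrictScalars_apply, LinearMap.restrictScalars_apply, h,
          toBaseChange_smul, map_smul, LinearMap.smul_apply, map_pow, map_neg, map_one]
      · intro (l : FA.ι) hl
        change inclA k p q (Finsupp.single i r l) ≠ 0 at hl
        have : l = i := by
          by_contra hne
          exact hl (by rw [Finsupp.single_eq_of_ne hne, map_zero])
        rw [this]
        rfl

end Tensor

end FreeComplex

end

noncomputable section

namespace FreeComplex

open TensorProduct

/-! ### The tensor product of two resolutions is a resolution -/

section TensorAugmentation

variable {k : Type*} [Field k] {p q : ℕ}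

section Ideals

variable (I : Ideal (MvPolynomial (Fin p) k)) (J : Ideal (MvPolynomial (Fin q) k))

/-- The ideal `I R + J R`. -/
abbrev sumIdeal : Ideal (MvPolynomial (Fin p ⊕ Fin q) k) := I.map (inclA k p q) ⊔ J.map (inclB k p q)

/-- The map `R_A/I → R/(I R + J R)`. -/
def quotA : (MvPolynomial (Fin p) k ⧸ I) →ₐ[k] (MvPolynomial (Fin p ⊕ Fin q) k ⧸ sumIdeal I J) :=
  Ideal.quotientMapₐ _ (MvPolynomial.rename Sum.inl)
    (Ideal.map_le_iff_le_comap.1 (le_sup_left : I.map (inclA k p q) ≤ sumIdeal I J))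

/-- The map `R_B/J → R/(I R + J R)`. -/
def quotB : (MvPolynomial (Fin q) k ⧸ J) →ₐ[k] (MvPolynomial (Fin p ⊕ Fin q) k ⧸ sumIdeal I J) :=
  Ideal.quotientMapₐ _ (MvPolynomial.rename Sum.inr)
    (Ideal.map_le_iff_le_comap.1 (le_sup_right : J.map (inclB k p q) ≤ sumIdeal I J))

theorem quotA_mk (f : MvPolynomial (Fin p) k) :
    quotA I J (Ideal.Quotient.mk I f) = Ideal.Quotient.mk (sumIdeal I J) (inclA k p q f) := rfl

theorem quotB_mk (f : MvPolynomial (Fin q) k) :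
    quotB I J (Ideal.Quotient.mk J f) = Ideal.Quotient.mk (sumIdeal I J) (inclB k p q f) := rfl

theorem quotA_smul (f : MvPolynomial (Fin p) k) (z : MvPolynomial (Fin p) k ⧸ I) :
    quotA I J (f • z) = inclA k p q f • quotA I J z := by
  obtain ⟨g, rfl⟩ := Ideal.Quotient.mk_surjective z
  exact congrArg (Ideal.Quotient.mk (sumIdeal I J)) (map_mul (inclA k p q) f g)

theorem quotB_smul (f : MvPolynomial (Fin q) k) (z : MvPolynomial (Fin q) k ⧸ J) :
    quotB I J (f • z) = inclB k p q f • quotB I J z := by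
  obtain ⟨g, rfl⟩ := Ideal.Quotient.mk_surjective z
  exact congrArg (Ideal.Quotient.mk (sumIdeal I J)) (map_mul (inclB k p q) f g)

/-- The multiplication `R_A/I ⊗ R_B/J → R/(I R + J R)`. -/
def quotTensor : (MvPolynomial (Fin p) k ⧸ I) ⊗[k] (MvPolynomial (Fin q) k ⧸ J) →ₐ[k]
    (MvPolynomial (Fin p ⊕ Fin q) k ⧸ sumIdeal I J) :=
  Algebra.TensorProduct.productMap (quotA I J) (quotB I J)

/-- A left inverse is induced by the evaluation `φ` at the classes of the variables: restricted to
either block of variables, `φ` is the quotient map followed by an inclusion into the tensor product,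
so it kills `I R + J R`. -/
theorem quotTensor_injective : Function.Injective (quotTensor I J) := by
  let φ : MvPolynomial (Fin p ⊕ Fin q) k →ₐ[k]
      (MvPolynomial (Fin p) k ⧸ I) ⊗[k] (MvPolynomial (Fin q) k ⧸ J) :=
    MvPolynomial.aeval (R := k) (Sum.elim (fun i => Ideal.Quotient.mk I (MvPolynomial.X i) ⊗ₜ[k] 1)
      fun j => 1 ⊗ₜ[k] Ideal.Quotient.mk J (MvPolynomial.X j))
  have hA : φ.comp (MvPolynomial.rename Sum.inl) =
      Algebra.TensorProduct.includeLeft.comp (Ideal.Quotient.mkₐ k I) := by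
    ext i
    simp [φ]
  have hB : φ.comp (MvPolynomial.rename Sum.inr) =
      Algebra.TensorProduct.includeRight.comp (Ideal.Quotient.mkₐ k J) := by
    ext i
    simp [φ]
  have hφ : ∀ f ∈ sumIdeal I J, φ f = 0 := by
    intro f hf
    suffices h : sumIdeal I J ≤ RingHom.ker φ from h hf
    refine sup_le (Ideal.map_le_iff_le_comap.2 fun g hg => ?_)
      (Ideal.map_le_iff_le_comap.2 fun g hg => ?_)
    · have h1 := DFunLike.congr_fun hA g
      have h2 : Ideal.Quotient.mkₐ k I g = 0 := Ideal.Quotient.eq_zero_iff_mem.2 hg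
      rw [AlgHom.comp_apply, AlgHom.comp_apply, h2, map_zero] at h1
      exact h1
    · have h1 := DFunLike.congr_fun hB g
      have h2 : Ideal.Quotient.mkₐ k J g = 0 := Ideal.Quotient.eq_zero_iff_mem.2 hg
      rw [AlgHom.comp_apply, AlgHom.comp_apply, h2, map_zero] at h1
      exact h1
  have key : (Ideal.Quotient.liftₐ _ φ hφ).comp (quotTensor I J) = AlgHom.id k _ := by
    apply Algebra.TensorProduct.ext
    · refine Ideal.Quotient.algHom_ext k (MvPolynomial.algHom_ext fun i => ?_)
      change φ (MvPolynomial.rename Sum.inl (MvPolynomial.X i) *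
        MvPolynomial.rename Sum.inr 1) = _
      simp [φ]
    · refine Ideal.Quotient.algHom_ext k (MvPolynomial.algHom_ext fun i => ?_)
      change φ (MvPolynomial.rename Sum.inl 1 *
        MvPolynomial.rename Sum.inr (MvPolynomial.X i)) = _
      simp [φ]
  exact Function.LeftInverse.injective (DFunLike.congr_fun key)

end Ideals

variable {I : Ideal (MvPolynomial (Fin p) k)} {J : Ideal (MvPolynomial (Fin q) k)}
  {FA : FreeComplex (MvPolynomial (Fin p) k)} {FB : FreeComplex (MvPolynomial (Fin q) k)}
  (εA : (FA.ι →₀ MvPolynomial (Fin p) k) →ₗ[MvPolynomial (Fin p) k] (MvPolynomial (Fin p) k ⧸ I))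
  (εB : (FB.ι →₀ MvPolynomial (Fin q) k) →ₗ[MvPolynomial (Fin q) k] (MvPolynomial (Fin q) k ⧸ J))

/-- The augmentation of the tensor product of two augmented complexes. -/
def tensorAug : ((FA.baseChange (inclA k p q)).ι × (FB.baseChange (inclB k p q)).ι →₀
      MvPolynomial (Fin p ⊕ Fin q) k) →ₗ[MvPolynomial (Fin p ⊕ Fin q) k]
    (MvPolynomial (Fin p ⊕ Fin q) k ⧸ sumIdeal I J) :=
  Finsupp.linearCombination _ fun x : FA.ι × FB.ι =>
    quotA I J (εA (Finsupp.single x.1 1)) * quotB I J (εB (Finsupp.single x.2 1))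

theorem tensorAug_single (x : FA.ι × FB.ι) :
    tensorAug εA εB (Finsupp.single x 1 : FA.ι × FB.ι →₀ MvPolynomial (Fin p ⊕ Fin q) k) =
      quotA I J (εA (Finsupp.single x.1 1)) * quotB I J (εB (Finsupp.single x.2 1)) :=
  (Finsupp.linearCombination_single _ _ _).trans (one_smul _ _)

theorem tensorAug_tensorEquiv_tmul (x : FA.ι →₀ MvPolynomial (Fin p) k)
    (y : FB.ι →₀ MvPolynomial (Fin q) k) :
    tensorAug εA εB (tensorEquiv FA FB (x ⊗ₜ y)) = quotA I J (εA x) * quotB I J (εB y) := by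
  induction x using Finsupp.induction_linear with
  | zero => simp
  | add x x' hx hx' => simp only [add_tmul, map_add, hx, hx', add_mul]
  | single i r =>
    induction y using Finsupp.induction_linear with
    | zero => simp
    | add y y' hy hy' => simp only [tmul_add, map_add, hy, hy', mul_add]
    | single j s =>
      rw [tensorEquiv_tmul, toBaseChange_single, toBaseChange_single]
      have h1 : Finsupp.single i r = r • Finsupp.single i (1 : MvPolynomial (Fin p) k) := by simp
      have h2 : Finsupp.single j s = s • Finsupp.single j (1 : MvPolynomial (Fin q) k) := by simp
      rw [h1, h2, map_smul εA, map_smul εB, quotA_smul, quotB_smul, smul_mul_smul_comm]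
      refine (congrArg (tensorAug εA εB) (tmul_single_single _ _ i j _ _)).trans ?_
      exact Finsupp.linearCombination_single _ _ _

/-- Together with `quotTensor_injective`, this identifies the kernel of the augmentation with that
of `εA ⊗ εB`. -/
theorem tensorAug_tensorEquiv (w : (FA.ι →₀ MvPolynomial (Fin p) k) ⊗[k]
    (FB.ι →₀ MvPolynomial (Fin q) k)) :
    tensorAug εA εB (tensorEquiv FA FB w) =
      quotTensor I J (TensorProduct.map (εA.restrictScalars k) (εB.restrictScalars k) w) := by
  induction w with
  | zero => simp
  | add w w' hw hw' => simp only [map_add, hw, hw']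
  | tmul x y =>
    rw [tensorAug_tensorEquiv_tmul, map_tmul]
    rfl

variable {εA εB}

theorem IsAugmented.tensorAug_comp (hA : FA.IsAugmented I εA) (hB : FB.IsAugmented J εB)
    (z : (FA.baseChange (inclA k p q)).ι × (FB.baseChange (inclB k p q)).ι →₀
      MvPolynomial (Fin p ⊕ Fin q) k) :
    tensorAug εA εB (Finsupp.linearCombination (MvPolynomial (Fin p ⊕ Fin q) k)
      (tensorDiff (FA.baseChange (inclA k p q)) (FB.baseChange (inclB k p q))) z) = 0 := by
  obtain ⟨w, rfl⟩ := (tensorEquiv FA FB).surjective z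
  rw [tensorEquiv_d, tensorAug_tensorEquiv]
  induction w with
  | zero => simp
  | add w w' hw hw' => simp only [map_add, hw, hw', add_zero]
  | tmul x y =>
    simp [tensorEnd_tmul, hA.comp_d, hB.comp_d]

/-- In the homotopy identity `D H w + H D w + (P ⊗ Q) w = w` the maps `P` and `Q` factor through
`εA` and `εB`. For a cycle `w` of augmentation zero only `D H w = w` remains. -/
theorem IsAugmented.tensorAug_exact (hA : FA.IsAugmented I εA) (hB : FB.IsAugmented J εB)
    (z : (FA.baseChange (inclA k p q)).ι × (FB.baseChange (inclB k p q)).ι →₀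
      MvPolynomial (Fin p ⊕ Fin q) k)
    (hz : Finsupp.linearCombination (MvPolynomial (Fin p ⊕ Fin q) k)
      (tensorDiff (FA.baseChange (inclA k p q)) (FB.baseChange (inclB k p q))) z = 0)
    (hεz : tensorAug εA εB z = 0) :
    ∃ y, Finsupp.linearCombination (MvPolynomial (Fin p ⊕ Fin q) k)
      (tensorDiff (FA.baseChange (inclA k p q)) (FB.baseChange (inclB k p q))) y = z := by
  obtain ⟨w, rfl⟩ := (tensorEquiv FA FB).surjective z
  rw [tensorEquiv_d, LinearEquiv.map_eq_zero_iff] at hz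
  rw [tensorAug_tensorEquiv, map_eq_zero_iff _ (quotTensor_injective I J)] at hεz
  obtain ⟨h, s, hh, hσh, hds, hσs, hεσ⟩ := hA.exists_contraction k
  -- The sign in the tensor differential acts on the first factor, so the second contraction need
  -- not be compatible with it.
  obtain ⟨g, t, hg, -⟩ := hB.exists_contraction k
  have key := tensor_homotopy (d := FA.d.restrictScalars k) (h := h)
    (P := s ∘ₗ εA.restrictScalars k) (σ := FA.sign.restrictScalars k)
    (e := FB.d.restrictScalars k) (g := g) (Q := t ∘ₗ εB.restrictScalars k) hh hg hσh
    (fun x => hds _) (fun x => by simp [hA.comp_d]) (fun x => hσs _) (fun x => by simp [hεσ]) w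
  rw [hz, map_zero, add_zero, TensorProduct.map_comp, LinearMap.comp_apply, hεz, map_zero,
    add_zero] at key
  exact ⟨tensorEquiv FA FB _, by rw [tensorEquiv_d, key]⟩

/-- The tensor product over `R` of resolutions of `R_A/I` and `R_B/J` is a resolution of
`R/(I R + J R)`. -/
theorem IsAugmented.tensor (hA : FA.IsAugmented I εA) (hB : FB.IsAugmented J εB) :
    ((FA.baseChange (inclA k p q)).tensor (FB.baseChange (inclB k p q))).IsAugmented
      (sumIdeal I J) (tensorAug εA εB) where
  eq_zero := by
    rintro (x : FA.ι × FB.ι) hx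
    have hx : FA.hdeg x.1 + FB.hdeg x.2 ≠ 0 := hx
    refine (tensorAug_single εA εB x).trans ?_
    rcases Nat.eq_zero_or_pos (FA.hdeg x.1) with h | h
    · rw [hB.eq_zero x.2 (by omega), map_zero, mul_zero]
    · rw [hA.eq_zero x.1 (by omega), map_zero, zero_mul]
  surjective z := by
    obtain ⟨f, rfl⟩ := Ideal.Quotient.mk_surjective z
    obtain ⟨x, hx⟩ := hA.surjective 1
    obtain ⟨y, hy⟩ := hB.surjective 1
    refine ⟨f • tensorEquiv FA FB (x ⊗ₜ y), ?_⟩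
    refine (map_smul (tensorAug εA εB) f _).trans ?_
    rw [tensorAug_tensorEquiv_tmul, hx, hy, map_one, map_one, mul_one]
    exact congrArg (Ideal.Quotient.mk (sumIdeal I J)) (mul_one f)
  comp_d := hA.tensorAug_comp hB
  exact := hA.tensorAug_exact hB

end TensorAugmentation

end FreeComplex

end

/-! ### Comparison of resolutions and invariance of the ranks -/

noncomputable section

namespace FreeComplex

/-- A form of dependent choice. -/
theorem exists_seq_of_step {α : Type*} {p : ℕ → α → Prop} {r : ℕ → α → α → Prop}
    (h0 : ∃ a, p 0 a) (hs : ∀ n a, p n a → ∃ b, p (n + 1) b ∧ r n a b) :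
    ∃ f : ℕ → α, (∀ n, p n (f n)) ∧ ∀ n, r n (f n) (f (n + 1)) := by
  choose! g hg using hs
  let f : ℕ → α := fun n => Nat.rec h0.choose (fun n a => g n a) n
  have hf : ∀ n, p n (f n) := fun n => by
    induction n with
    | zero => exact h0.choose_spec
    | succ n ih => exact (hg n _ ih).1
  exact ⟨f, hf, fun n => (hg n _ (hf n)).2⟩

section Comparison

variable {R : Type*} [CommRing R] {I : Ideal R} {F G : FreeComplex R}
  {εF : (F.ι →₀ R) →ₗ[R] (R ⧸ I)} {εG : (G.ι →₀ R) →ₗ[R] (R ⧸ I)}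

theorem IsAugmented.exact_part (hG : G.IsAugmented I εG) {n : ℕ} {x : G.ι →₀ R}
    (hx : x ∈ G.part n) (hd : G.d x = 0) (hε : εG x = 0) : ∃ y ∈ G.part (n + 1), G.d y = x := by
  obtain ⟨y, rfl⟩ := hG.exact x hd hε
  exact ⟨_, G.proj_mem_part (n + 1) y, by rw [← proj_d_succ, G.proj_of_mem_part hx]⟩

/-- A linear map on the `n`-th module of a complex of free modules may be prescribed by a relation
on the basis elements. -/
theorem exists_linearMap {M : Type*} [AddCommGroup M] [Module R M] (n : ℕ) {P : F.ι → M → Prop}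
    (h : ∀ j, F.hdeg j = n → ∃ y, P j y) :
    ∃ ψ : (F.ι →₀ R) →ₗ[R] M, ∀ j, F.hdeg j = n → P j (ψ (Finsupp.single j 1)) := by
  choose! y hy using h
  exact ⟨Finsupp.linearCombination R y, fun j hj => by simpa using hy j hj⟩

/-- The inductive step common to comparison maps and homotopies: freeness of `F` reduces the lifting
to basis elements, and exactness of `G` supplies it there. -/
theorem IsAugmented.exists_lift (hG : G.IsAugmented I εG) {n m : ℕ}
    (φ : (F.ι →₀ R) →ₗ[R] (G.ι →₀ R))
    (hφ : ∀ x ∈ F.part n, φ x ∈ G.part m ∧ G.d (φ x) = 0 ∧ εG (φ x) = 0) :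
    ∃ ψ : (F.ι →₀ R) →ₗ[R] (G.ι →₀ R),
      ∀ x ∈ F.part n, ψ x ∈ G.part (m + 1) ∧ G.d (ψ x) = φ x := by
  obtain ⟨ψ, hψ⟩ := exists_linearMap (F := F) n
    (P := fun j y => y ∈ G.part (m + 1) ∧ G.d y = φ (Finsupp.single j 1)) fun j hj => by
      obtain ⟨h1, h2, h3⟩ := hφ _ (hj ▸ F.single_mem_part j 1)
      exact hG.exact_part h1 h2 h3
  exact ⟨ψ, fun x hx => ⟨F.map_mem_of_mem_part (fun j hj => (hψ j hj).1) hx,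
    F.eqOn_part (f := G.d ∘ₗ ψ) (fun j hj => (hψ j hj).2) hx⟩⟩

/-- Comparison maps between two resolutions of the same module. -/
theorem IsAugmented.exists_comparison (hF : F.IsAugmented I εF) (hG : G.IsAugmented I εG) :
    ∃ f : ℕ → (F.ι →₀ R) →ₗ[R] (G.ι →₀ R), (∀ n, ∀ x ∈ F.part n, f n x ∈ G.part n) ∧
      (∀ x ∈ F.part 0, εG (f 0 x) = εF x) ∧
      ∀ n, ∀ x ∈ F.part (n + 1), G.d (f (n + 1) x) = f n (F.d x) := by
  -- The second clause of the invariant, that cycles of augmentation zero go to cycles of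
  -- augmentation zero, is what makes `φ ∘ₗ F.d` liftable at the next stage.
  refine Exists.elim (exists_seq_of_step
    (p := fun n (φ : (F.ι →₀ R) →ₗ[R] (G.ι →₀ R)) => (∀ x ∈ F.part n, φ x ∈ G.part n) ∧
      (∀ x ∈ F.part n, F.d x = 0 → εF x = 0 → G.d (φ x) = 0 ∧ εG (φ x) = 0) ∧
      (n = 0 → ∀ x ∈ F.part n, εG (φ x) = εF x))
    (r := fun n φ ψ => ∀ x ∈ F.part (n + 1), G.d (ψ x) = φ (F.d x)) ?_ ?_) ?_
  rotate_left 2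
  · rintro f ⟨hf, hr⟩
    exact ⟨f, fun n => (hf n).1, (hf 0).2.2 rfl, hr⟩
  · obtain ⟨ψ, hψ⟩ := exists_linearMap (F := F) 0
      (P := fun j y => y ∈ G.part 0 ∧ εG y = εF (Finsupp.single j 1)) fun j hj => by
        obtain ⟨y, hy⟩ := hG.surjective (εF (Finsupp.single j 1))
        exact ⟨_, G.proj_mem_part 0 y, by rw [hG.apply_proj, hy]⟩
    have h1 : ∀ x ∈ F.part 0, ψ x ∈ G.part 0 := fun x hx =>
      F.map_mem_of_mem_part (fun j hj => (hψ j hj).1) hx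
    have h2 : ∀ x ∈ F.part 0, εG (ψ x) = εF x := fun x hx =>
      F.eqOn_part (f := εG ∘ₗ ψ) (fun j hj => (hψ j hj).2) hx
    exact ⟨ψ, h1, fun x hx _ hε => ⟨G.d_eq_zero_of_mem_part_zero (h1 x hx), by rw [h2 x hx, hε]⟩,
      fun _ => h2⟩
  · rintro n φ ⟨h1, h2, -⟩
    obtain ⟨ψ, hψ⟩ := hG.exists_lift (n := n + 1) (m := n) (φ ∘ₗ F.d) fun x hx =>
      ⟨h1 _ (F.d_mem_part hx), h2 _ (F.d_mem_part hx) (F.d_d x) (hF.comp_d x)⟩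
    refine ⟨ψ, ⟨fun x hx => (hψ x hx).1, fun x hx hd _ => ⟨?_, ?_⟩, fun h => ?_⟩,
      fun x hx => (hψ x hx).2⟩
    · rw [(hψ x hx).2, LinearMap.comp_apply, hd, map_zero]
    · exact hG.apply_of_mem_part_succ (hψ x hx).1
    · omega

/-- An endomorphism of a resolution which induces zero is null-homotopic. -/
theorem IsAugmented.exists_homotopy (hF : F.IsAugmented I εF)
    (φ : ℕ → (F.ι →₀ R) →ₗ[R] (F.ι →₀ R)) (hpart : ∀ n, ∀ x ∈ F.part n, φ n x ∈ F.part n)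
    (hε : ∀ x ∈ F.part 0, εF (φ 0 x) = 0)
    (hd : ∀ n, ∀ x ∈ F.part (n + 1), F.d (φ (n + 1) x) = φ n (F.d x)) :
    ∃ h : ℕ → (F.ι →₀ R) →ₗ[R] (F.ι →₀ R), (∀ x ∈ F.part 0, F.d (h 0 x) = φ 0 x) ∧
      ∀ n, ∀ x ∈ F.part (n + 1), F.d (h (n + 1) x) = φ (n + 1) x - h n (F.d x) := by
  -- The invariant carries along that `φ (n + 1) - h ∘ₗ F.d` takes values in cycles, as the next
  -- lift requires. The equation in degree zero is recorded separately, there being no earlier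
  -- homotopy.
  refine Exists.elim (exists_seq_of_step
    (p := fun n (h : (F.ι →₀ R) →ₗ[R] (F.ι →₀ R)) => (∀ x ∈ F.part n, h x ∈ F.part (n + 1)) ∧
      (∀ x ∈ F.part (n + 1), F.d (φ (n + 1) x - h (F.d x)) = 0) ∧
      (n = 0 → ∀ x ∈ F.part n, F.d (h x) = φ n x))
    (r := fun n h h' => ∀ x ∈ F.part (n + 1), F.d (h' x) = φ (n + 1) x - h (F.d x)) ?_ ?_) ?_
  rotate_left 2
  · rintro h ⟨hh, hr⟩
    exact ⟨h, (hh 0).2.2 rfl, hr⟩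
  · obtain ⟨ψ, hψ⟩ := hF.exists_lift (n := 0) (m := 0) (φ 0) fun x hx =>
      ⟨hpart 0 x hx, F.d_eq_zero_of_mem_part_zero (hpart 0 x hx), hε x hx⟩
    refine ⟨ψ, fun x hx => (hψ x hx).1, fun x hx => ?_, fun _ x hx => (hψ x hx).2⟩
    rw [map_sub, hd 0 x hx, (hψ _ (F.d_mem_part hx)).2, sub_self]
  · rintro n h ⟨h1, h2, -⟩
    have hmem : ∀ x ∈ F.part (n + 1), (φ (n + 1) - h ∘ₗ F.d) x ∈ F.part (n + 1) := fun x hx =>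
      sub_mem (hpart _ x hx) (h1 _ (F.d_mem_part hx))
    obtain ⟨ψ, hψ⟩ := hF.exists_lift (n := n + 1) (m := n + 1) (φ (n + 1) - h ∘ₗ F.d) fun x hx =>
      ⟨hmem x hx, h2 x hx, hF.apply_of_mem_part_succ (hmem x hx)⟩
    refine ⟨ψ, ⟨fun x hx => (hψ x hx).1, fun x hx => ?_, fun h => by omega⟩,
      fun x hx => (hψ x hx).2⟩
    rw [map_sub, hd _ x hx, (hψ _ (F.d_mem_part hx)).2]
    simp [F.d_d]

theorem apply_mem_of_forall_mem {ι κ : Type*} {m : Ideal R} (h : (ι →₀ R) →ₗ[R] (κ →₀ R))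
    {x : ι →₀ R} (hx : ∀ i, x i ∈ m) (j : κ) : h x j ∈ m := by
  rw [← Finsupp.sum_single x, Finsupp.sum, map_sum, Finsupp.finsetSum_apply]
  refine Ideal.sum_mem _ fun i _ => ?_
  rw [← mul_one (x i), ← smul_eq_mul, ← Finsupp.smul_single, map_smul, Finsupp.smul_apply,
    smul_eq_mul]
  exact Ideal.mul_mem_right _ _ (hx i)

theorem d_apply_mem {m : Ideal R} (hm : ∀ j i, F.diff j i ∈ m) (x : F.ι →₀ R) (i : F.ι) :
    F.d x i ∈ m := by
  induction x using Finsupp.induction_linear with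
  | zero => simp
  | add x y hx hy => rw [map_add]; exact add_mem hx hy
  | single j r => rw [d_single]; exact Ideal.mul_mem_left _ _ (hm j i)

/-- Composites of comparison maps between minimal resolutions are the identity modulo the maximal
ideal. -/
theorem IsAugmented.exists_comp_sub_mem {m : Ideal R} (hF : F.IsAugmented I εF)
    (hG : G.IsAugmented I εG) (hFm : ∀ j i, F.diff j i ∈ m) (n : ℕ) :
    ∃ (f : (F.ι →₀ R) →ₗ[R] (G.ι →₀ R)) (g : (G.ι →₀ R) →ₗ[R] (F.ι →₀ R)),
      (∀ x ∈ F.part n, f x ∈ G.part n) ∧ ∀ x ∈ F.part n, ∀ j, (g (f x) - x) j ∈ m := by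
  obtain ⟨f, hf1, hf2, hf3⟩ := hF.exists_comparison hG
  obtain ⟨g, hg1, hg2, hg3⟩ := hG.exists_comparison hF
  -- The difference from the identity is `d h + h d`, and both terms have coefficients in `m`
  -- because `d` has.
  obtain ⟨h, hh0, hh⟩ := hF.exists_homotopy (fun n => g n ∘ₗ f n - LinearMap.id)
    (fun n x hx => sub_mem (hg1 n _ (hf1 n x hx)) hx)
    (fun x hx => by simp [hg2 _ (hf1 0 x hx), hf2 x hx])
    (fun n x hx => by simp [hg3 n _ (hf1 (n + 1) x hx), hf3 n x hx])
  refine ⟨f n, g n, hf1 n, fun x hx j => ?_⟩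
  cases n with
  | zero =>
    have := d_apply_mem hFm (h 0 x) j
    rw [hh0 x hx] at this
    exact this
  | succ n =>
    have h1 := d_apply_mem hFm (h (n + 1) x) j
    have h2 := apply_mem_of_forall_mem (h n) (d_apply_mem hFm x) j
    rw [hh n x hx] at h1
    have h3 := add_mem h1 h2
    rw [Finsupp.sub_apply, sub_add_cancel] at h3
    exact h3

theorem rank_natCast (F : FreeComplex R) (n : ℕ) :
    F.rank n = (F.finite_hdeg n).toFinset.card := by
  rw [rank, ← Set.ncard_eq_toFinset_card _ (F.finite_hdeg n)]
  simp only [Nat.cast_inj]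

theorem rank_of_neg (F : FreeComplex R) {i : ℤ} (hi : i < 0) : F.rank i = 0 := by
  have : {j : F.ι | (F.hdeg j : ℤ) = i} = ∅ := Set.eq_empty_of_forall_notMem fun j hj => by
    have hj : (F.hdeg j : ℤ) = i := hj
    omega
  rw [rank, this, Set.ncard_empty]

/-- Modulo the kernel of `κ` the composite of comparison maps `F → G → F` is the identity. So the
rows of the matrix of `F_n → G_n` over `K`, one for each basis element of `F_n`, are linearly
independent. Only the source has to be minimal; two minimal resolutions are compared in both
directions. -/
theorem IsAugmented.rank_le {K : Type*} [Field K] {κ : R →+* K} (hF : F.IsAugmented I εF)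
    (hG : G.IsAugmented I εG) (hFm : ∀ j i, F.diff j i ∈ RingHom.ker κ) (n : ℕ) :
    F.rank n ≤ G.rank n := by
  classical
  obtain ⟨f, g, hf, hgf⟩ := hF.exists_comp_sub_mem hG hFm n
  set A := (F.finite_hdeg n).toFinset
  set B := (G.finite_hdeg n).toFinset
  have key : ∀ j ∈ A, ∀ j', ∑ i ∈ B, κ (f (Finsupp.single j 1) i) *
      κ (g (Finsupp.single i 1) j') = if j = j' then 1 else 0 := by
    intro j hj j'
    have hj : F.hdeg j = n := by simpa [A] using hj
    have h1 := hgf (Finsupp.single j 1) (hj ▸ F.single_mem_part j 1) j'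
    rw [RingHom.mem_ker, Finsupp.sub_apply, map_sub, sub_eq_zero] at h1
    have h2 : f (Finsupp.single j 1) = ∑ i ∈ B, f (Finsupp.single j 1) i • Finsupp.single i 1 := by
      have hm := G.mem_part.1 (hf _ (hj ▸ F.single_mem_part j 1))
      conv_lhs => rw [← Finsupp.sum_single (f (Finsupp.single j 1)), Finsupp.sum]
      simp only [Finsupp.smul_single, smul_eq_mul, mul_one]
      refine Finset.sum_subset (fun i hi => ?_) fun i _ hi => ?_
      · simpa [B] using hm i (by simpa using hi)
      · rw [Finsupp.notMem_support_iff.1 hi, Finsupp.single_zero]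
    rw [h2] at h1
    simp only [map_sum, map_smul, Finsupp.finsetSum_apply, Finsupp.smul_apply, smul_eq_mul,
      map_mul] at h1
    rw [h1, Finsupp.single_apply]
    split_ifs <;> simp
  have hli : LinearIndependent K fun (j : A) (i : B) => κ (f (Finsupp.single j 1) i) := by
    rw [Fintype.linearIndependent_iff]
    intro c hc j'
    have h1 : ∑ i : B, (∑ j : A, c j * κ (f (Finsupp.single (j : F.ι) 1) i)) *
        κ (g (Finsupp.single (i : G.ι) 1) j') = 0 :=
      Finset.sum_eq_zero fun i _ => by
        have := congrFun hc i
        simp only [Finset.sum_apply, Pi.smul_apply, smul_eq_mul] at this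
        rw [this]
        simp
    simp only [Finset.sum_mul] at h1
    rw [Finset.sum_comm] at h1
    have h2 : ∀ j : A, ∑ i : B, c j * κ (f (Finsupp.single (j : F.ι) 1) i) *
        κ (g (Finsupp.single (i : G.ι) 1) j') = if j = j' then c j else 0 := by
      intro j
      simp only [mul_assoc]
      rw [← Finset.mul_sum, Finset.sum_coe_sort B fun i => κ (f (Finsupp.single (j : F.ι) 1) i) *
        κ (g (Finsupp.single (i : G.ι) 1) j'), key j j.2 j', mul_ite, mul_one, mul_zero]
      simp only [Subtype.coe_inj]
    rw [Finset.sum_congr rfl fun j _ => h2 j, Finset.sum_ite_eq' , if_pos (Finset.mem_univ _)] at h1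
    exact h1
  have := hli.fintype_card_le_finrank
  rw [rank_natCast, rank_natCast]
  simpa using this

end Comparison

/-! ### Hilbert's syzygy theorem -/

section Length

variable {R S : Type*} [CommRing R] [CommRing S]

/-- The complex is exact in all homological degrees greater than `N`. -/
def ExactAbove (F : FreeComplex R) (N : ℕ) : Prop :=
  ∀ n, N ≤ n → ∀ x ∈ F.part (n + 1), F.d x = 0 → ∃ y ∈ F.part (n + 2), F.d y = x

theorem toBaseChange_mem_part {F : FreeComplex R} (f : R →+* S) {n : ℕ} {x : F.ι →₀ R}
    (hx : x ∈ F.part n) : F.toBaseChange f x ∈ (F.baseChange f).part n :=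
  (mem_part _).2 fun j hj => (mem_part _).1 hx j fun h => hj <| by
    rw [toBaseChange_apply, h, map_zero]

theorem exists_toBaseChange_eq {F : FreeComplex R} {f : R →+* S} (hf : Function.Surjective f)
    {n : ℕ} {y : (F.baseChange f).ι →₀ S} (hy : y ∈ (F.baseChange f).part n) :
    ∃ x ∈ F.part n, F.toBaseChange f x = y := by
  classical
  -- The section must send `0` to `0`, so that lifting coefficientwise creates no new support and
  -- keeps the homological degree.
  let s : S → R := fun b => if b = 0 then 0 else (hf b).choose
  have hs : ∀ b, f (s b) = b := fun b => by
    by_cases h : b = 0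
    · simp [s, h]
    · simpa [s, h] using (hf b).choose_spec
  have hs0 : s 0 = 0 := by simp [s]
  let x : F.ι →₀ R := Finsupp.mapRange s hs0 y
  have hx : ∀ j, x j = s (y j) := fun j => Finsupp.mapRange_apply
  refine ⟨x, F.mem_part.2 fun j hj => (mem_part _).1 hy j fun h => hj ?_, Finsupp.ext fun j => ?_⟩
  · rw [hx, h, hs0]
  · exact (congrArg f (hx j)).trans (hs _)

/-- The last clause keeps the quotient in the same homological degree as `x`. -/
theorem exists_eq_smul_of_forall_dvd {ι : Type*} {r : R} {x : ι →₀ R} (h : ∀ i, r ∣ x i) :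
    ∃ y : ι →₀ R, x = r • y ∧ ∀ i, y i ≠ 0 → x i ≠ 0 := by
  classical
  choose c hc using h
  refine ⟨Finsupp.onFinset x.support (fun i => if x i = 0 then 0 else c i) (fun i => ?_), ?_, ?_⟩
  · simp +contextual
  · ext i
    by_cases h : x i = 0
    · simp [h]
    · simpa [h] using hc i
  · intro i
    simp +contextual

/-- This is the long exact sequence of `0 → F → F → F/rF → 0` by elements. A cycle modulo `r` lifts
to `x` with `d x = r y`. As `r` is a nonzerodivisor, `y` is a cycle, say `y = d z`; then `x - r z`
is a cycle, hence a boundary, and it has the same image as `x`. -/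
theorem ExactAbove.baseChange {F : FreeComplex R} {N : ℕ} (hF : F.ExactAbove N) {f : R →+* S}
    (hf : Function.Surjective f) {r : R} (hr : ∀ a, r * a = 0 → a = 0)
    (hker : ∀ a, f a = 0 ↔ r ∣ a) : (F.baseChange f).ExactAbove (N + 1) := by
  intro n hn x' hx' hdx'
  -- Exactness is used at `y`, one degree below `x`; this is the degree lost in passing from `N` to
  -- `N + 1`.
  obtain ⟨n, rfl⟩ : ∃ m, n = m + 1 := ⟨n - 1, by omega⟩
  obtain ⟨x, hx, rfl⟩ := exists_toBaseChange_eq hf hx'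
  rw [d_toBaseChange] at hdx'
  obtain ⟨y, hy, hy0⟩ := exists_eq_smul_of_forall_dvd (r := r) (x := F.d x) fun i =>
    (hker _).1 (DFunLike.congr_fun hdx' i)
  have hdy : F.d y = 0 := by
    have h : r • F.d y = 0 := by rw [← map_smul, ← hy, F.d_d]
    ext i
    exact hr _ (DFunLike.congr_fun h i)
  obtain ⟨z, hz, rfl⟩ := hF n (by omega) y
    (F.mem_part.2 fun i hi => F.mem_part.1 (F.d_mem_part hx) i (hy0 i hi)) hdy
  obtain ⟨w, hw, hwx⟩ := hF (n + 1) (by omega) (x - r • z)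
    (sub_mem hx ((F.part _).smul_mem r hz)) (by rw [map_sub, map_smul, hy, sub_self])
  refine ⟨F.toBaseChange f w, toBaseChange_mem_part f hw, ?_⟩
  rw [d_toBaseChange, hwx, map_sub, toBaseChange_smul, (hker r).2 dvd_rfl, zero_smul, sub_zero]

/-- Hilbert's syzygy theorem: a minimal complex over a polynomial ring in `p` variables which is
exact above homological degree `N` vanishes above homological degree `N + p`. -/
theorem ExactAbove.hdeg_le {k : Type*} [Field k] (p : ℕ) :
    ∀ {F : FreeComplex (MvPolynomial (Fin p) k)} {N : ℕ}, F.ExactAbove N →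
      (∀ j i, MvPolynomial.constantCoeff (F.diff j i) = 0) → ∀ j, F.hdeg j ≤ N + p := by
  induction p with
  | zero =>
    intro F N hF hm j
    by_contra! hj
    -- Without variables, entries with zero constant term vanish, so `d = 0`, and exactness leaves
    -- nothing above degree `N`.
    have hinj : Function.Injective
        (MvPolynomial.constantCoeff : MvPolynomial (Fin 0) k →+* k) :=
      (MvPolynomial.isEmptyRingEquiv k (Fin 0)).injective
    have hd : ∀ x, F.d x = 0 := fun x => Finsupp.ext fun i =>
      d_apply_mem (m := ⊥) (F := F) (fun j i => hinj (by rw [hm, map_zero])) x i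
    obtain ⟨n, hn⟩ : ∃ n, F.hdeg j = n + 1 := ⟨F.hdeg j - 1, by omega⟩
    obtain ⟨y, -, hy⟩ := hF n (by omega) (Finsupp.single j 1) (hn ▸ F.single_mem_part j 1) (hd _)
    rw [hd] at hy
    have := DFunLike.congr_fun hy j
    simp at this
  | succ p ih =>
    intro F N hF hm j
    -- `f` sets the variable `X 0` to zero. The number of variables drops by one while the exactness
    -- bound rises by one, so the sum `N + p` is preserved.
    let f : MvPolynomial (Fin (p + 1)) k →+* MvPolynomial (Fin p) k :=
      Polynomial.constantCoeff.comp (MvPolynomial.finSuccEquiv k p).toRingEquiv.toRingHom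
    have hfX : ∀ g, f g = (MvPolynomial.finSuccEquiv k p g).coeff 0 := fun g => rfl
    have h1 := hF.baseChange (f := f) (r := MvPolynomial.X 0)
      (fun g => ⟨(MvPolynomial.finSuccEquiv k p).symm (Polynomial.C g), by simp [hfX]⟩)
      (fun a ha => (mul_eq_zero.1 ha).resolve_left (MvPolynomial.X_ne_zero 0))
      (fun a => by
        rw [hfX, ← Polynomial.X_dvd_iff, ← MvPolynomial.finSuccEquiv_X_zero,
          map_dvd_iff])
    have h2 := ih h1 (fun j i => ?_) j
    · have h2 : F.hdeg j ≤ N + 1 + p := h2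
      omega
    · have h3 : ∀ g, MvPolynomial.constantCoeff (f g) = MvPolynomial.constantCoeff g := fun g => by
        have : (MvPolynomial.constantCoeff.comp f : MvPolynomial (Fin (p + 1)) k →+* k) =
            MvPolynomial.constantCoeff := by
          refine MvPolynomial.ringHom_ext (fun a => ?_) fun i => ?_
          · simp [hfX, MvPolynomial.finSuccEquiv_apply]
          · refine Fin.cases ?_ (fun i => ?_) i
            · simp [hfX, MvPolynomial.finSuccEquiv_X_zero]
            · simp [hfX, MvPolynomial.finSuccEquiv_X_succ]
        exact DFunLike.congr_fun this g
      exact (h3 _).trans (hm j i)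

end Length

end FreeComplex

end

/-! ### Homogeneity and minimality of tensor products and cones -/

noncomputable section

theorem isWeightedHomogeneous_rename {k σ τ : Type*} [CommSemiring k] {w : σ → ℕ} {w' : τ → ℕ}
    {e : σ → τ} (he : ∀ s, w' (e s) = w s) {f : MvPolynomial σ k} {m : ℕ}
    (hf : MvPolynomial.IsWeightedHomogeneous w f m) :
    MvPolynomial.IsWeightedHomogeneous w' (MvPolynomial.rename e f) m := by
  intro d hd
  obtain ⟨u, rfl, hu⟩ := MvPolynomial.coeff_rename_ne_zero e f d hd
  rw [← hf hu]
  clear hd hu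
  induction u using Finsupp.induction_linear with
  | zero => simp
  | add u v hu hv => rw [Finsupp.mapDomain_add, map_add, map_add, hu, hv]
  | single s r => simp [Finsupp.weight_single, he]

theorem isWeightedHomogeneous_neg {k σ : Type*} [CommRing k] {w : σ → ℕ} {f : MvPolynomial σ k}
    {m : ℕ} (hf : MvPolynomial.IsWeightedHomogeneous w f m) :
    MvPolynomial.IsWeightedHomogeneous w (-f) m :=
  (MvPolynomial.weightedHomogeneousSubmodule k w m).neg_mem hf

namespace FreeComplex

section Graded

variable {k : Type*} [Field k] {σ τ : Type*}

/-- The differential is homogeneous of degree zero, and its entries have no constant term. -/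
structure IsMinimalGraded (w : σ → ℕ) (F : FreeComplex (MvPolynomial σ k)) : Prop where
  graded : ∀ j i, F.diff j i ≠ 0 →
    ∃ m, F.deg i + m = F.deg j ∧ MvPolynomial.IsWeightedHomogeneous w (F.diff j i) m
  minimal : ∀ j i, F.diff j i ∈ Ideal.span (Set.range (MvPolynomial.X (R := k) (σ := σ)))

theorem IsMinimalGraded.baseChange_rename {w : σ → ℕ} {w' : τ → ℕ}
    {F : FreeComplex (MvPolynomial σ k)} (hF : F.IsMinimalGraded w) {e : σ → τ}
    (he : ∀ s, w' (e s) = w s) :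
    (F.baseChange (MvPolynomial.rename e : MvPolynomial σ k →ₐ[k] MvPolynomial τ k).toRingHom).IsMinimalGraded
      w' where
  graded := by
    intro (j : F.ι) (i : F.ι) h
    change MvPolynomial.rename e (F.diff j i) ≠ 0 at h
    obtain ⟨m, hm, hw⟩ := hF.graded j i fun h0 => h (by rw [h0, map_zero])
    exact ⟨m, hm, isWeightedHomogeneous_rename he hw⟩
  minimal := by
    intro (j : F.ι) (i : F.ι)
    change MvPolynomial.rename e (F.diff j i) ∈ _
    have h := Ideal.mem_map_of_mem (MvPolynomial.rename e : _ →ₐ[k] MvPolynomial τ k) (hF.minimal j i)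
    rw [Ideal.map_span] at h
    refine Ideal.span_mono ?_ h
    rintro _ ⟨_, ⟨s, rfl⟩, rfl⟩
    exact ⟨e s, by simp⟩

/-- The two terms of the tensor differential never meet in one entry: this would require `x = y`,
and diagonal entries vanish because differentials lower the degree. Homogeneity and minimality are
thus inherited entry by entry. -/
theorem tensorDiff_apply {R : Type*} [CommRing R] (F G : FreeComplex R) (x y : F.ι × G.ι) :
    tensorDiff F G x y = 0 ∨ (x.2 = y.2 ∧ tensorDiff F G x y = F.diff x.1 y.1) ∨
      (x.1 = y.1 ∧ tensorDiff F G x y = (-1) ^ F.hdeg x.1 * G.diff x.2 y.2) := by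
  classical
  obtain ⟨i, j⟩ := x
  obtain ⟨i', j'⟩ := y
  simp only [tensorDiff, Finsupp.add_apply, Finsupp.smul_apply, tmul_apply, Finsupp.single_apply,
    smul_eq_mul]
  by_cases hi : i = i'
  · subst hi
    have h0 : F.diff i i = 0 := by
      by_contra h
      have := F.hdeg_of_diff_ne_zero i i h
      omega
    simp [h0]
  · by_cases hj : j = j'
    · simp [hi, hj]
    · simp [hi, hj]

theorem IsMinimalGraded.tensor {w : σ → ℕ} {F G : FreeComplex (MvPolynomial σ k)}
    (hF : F.IsMinimalGraded w) (hG : G.IsMinimalGraded w) : (F.tensor G).IsMinimalGraded w where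
  graded := by
    intro (x : F.ι × G.ι) (y : F.ι × G.ι) h
    change tensorDiff F G x y ≠ 0 at h
    change ∃ m, F.deg y.1 + G.deg y.2 + m = F.deg x.1 + G.deg x.2 ∧
      MvPolynomial.IsWeightedHomogeneous w (tensorDiff F G x y) m
    rcases tensorDiff_apply F G x y with h0 | ⟨h1, h2⟩ | ⟨h1, h2⟩
    · exact absurd h0 h
    · rw [h2] at h ⊢
      obtain ⟨m, hm, hw⟩ := hF.graded _ _ h
      exact ⟨m, by rw [h1]; omega, hw⟩
    · rw [h2] at h ⊢
      obtain ⟨m, hm, hw⟩ := hG.graded _ _ (right_ne_zero_of_mul h)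
      refine ⟨m, by rw [h1]; omega, ?_⟩
      rcases neg_one_pow_eq_or (MvPolynomial σ k) (F.hdeg x.1) with hs | hs
      · rwa [hs, one_mul]
      · rw [hs, neg_one_mul]
        exact isWeightedHomogeneous_neg hw
  minimal := by
    intro (x : F.ι × G.ι) (y : F.ι × G.ι)
    change tensorDiff F G x y ∈ _
    rcases tensorDiff_apply F G x y with h0 | ⟨h1, h2⟩ | ⟨h1, h2⟩
    · rw [h0]
      exact zero_mem _
    · rw [h2]
      exact hF.minimal _ _
    · rw [h2]
      exact Ideal.mul_mem_left _ _ (hG.minimal _ _)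

theorem IsMinimalGraded.cone {w : σ → ℕ} {F : FreeComplex (MvPolynomial σ k)}
    (hF : F.IsMinimalGraded w) {r : MvPolynomial σ k} {e : ℕ}
    (hr : MvPolynomial.IsWeightedHomogeneous w r e)
    (hrm : r ∈ Ideal.span (Set.range (MvPolynomial.X (R := k) (σ := σ)))) :
    (F.cone r e).IsMinimalGraded w where
  graded := by
    intro (x : F.ι ⊕ F.ι) (y : F.ι ⊕ F.ι) h
    change coneDiff F r x y ≠ 0 at h
    change ∃ m, Sum.elim F.deg (fun j => F.deg j + e) y + m =
        Sum.elim F.deg (fun j => F.deg j + e) x ∧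
      MvPolynomial.IsWeightedHomogeneous w (coneDiff F r x y) m
    rcases x with j | j <;> rcases y with i | i
    · simp only [coneDiff, lmapDomain_inl_apply_inl] at h ⊢
      exact hF.graded j i h
    · exact absurd (lmapDomain_inl_apply_inr F.ι (F.diff j) i) h
    · simp only [coneDiff, Finsupp.sub_apply, lmapDomain_inr_apply_inl, sub_zero] at h ⊢
      have hij : j = i := by
        by_contra hne
        exact h (Finsupp.single_eq_of_ne fun h => hne (Sum.inl_injective h.symm))
      subst hij
      exact ⟨e, rfl, by rwa [Finsupp.single_eq_same]⟩
    · have h0 : (Finsupp.single (Sum.inl j) r : F.ι ⊕ F.ι →₀ MvPolynomial σ k) (Sum.inr i) = 0 :=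
        Finsupp.single_eq_of_ne (by simp)
      simp only [coneDiff, Finsupp.sub_apply, lmapDomain_inr_apply_inr, h0, zero_sub] at h ⊢
      obtain ⟨m, hm, hw⟩ := hF.graded j i (neg_ne_zero.1 h)
      exact ⟨m, by simp only [Sum.elim_inr]; omega, isWeightedHomogeneous_neg hw⟩
  minimal := by
    intro (x : F.ι ⊕ F.ι) (y : F.ι ⊕ F.ι)
    change coneDiff F r x y ∈ _
    rcases x with j | j <;> rcases y with i | i
    · simp only [coneDiff, lmapDomain_inl_apply_inl]
      exact hF.minimal j i
    · simp only [coneDiff, lmapDomain_inl_apply_inr]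
      exact zero_mem _
    · classical
      simp only [coneDiff, Finsupp.sub_apply, lmapDomain_inr_apply_inl, sub_zero,
        Finsupp.single_apply]
      split_ifs
      · exact hrm
      · exact zero_mem _
    · have h0 : (Finsupp.single (Sum.inl j) r : F.ι ⊕ F.ι →₀ MvPolynomial σ k) (Sum.inr i) = 0 :=
        Finsupp.single_eq_of_ne (by simp)
      simp only [coneDiff, Finsupp.sub_apply, lmapDomain_inr_apply_inr, h0, zero_sub]
      exact neg_mem (hF.minimal j i)

theorem IsMinimalGradedFreeResolution.isMinimalGraded {w : σ → ℕ} {I : Ideal (MvPolynomial σ k)}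
    {F : FreeComplex (MvPolynomial σ k)} (hF : F.IsMinimalGradedFreeResolution w I) :
    F.IsMinimalGraded w :=
  ⟨hF.graded, hF.minimal⟩

/-- The tensor product of minimal graded free resolutions of `R_A/I` and `R_B/J` is a minimal
graded free resolution of `R/(I R + J R)`. -/
theorem IsMinimalGradedFreeResolution.tensor {p q : ℕ} {wA : Fin p → ℕ} {wB : Fin q → ℕ}
    {w : Fin p ⊕ Fin q → ℕ} (hwA : ∀ i, w (Sum.inl i) = wA i) (hwB : ∀ j, w (Sum.inr j) = wB j)
    {I : Ideal (MvPolynomial (Fin p) k)} {J : Ideal (MvPolynomial (Fin q) k)}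
    {FA : FreeComplex (MvPolynomial (Fin p) k)} {FB : FreeComplex (MvPolynomial (Fin q) k)}
    (hA : FA.IsMinimalGradedFreeResolution wA I) (hB : FB.IsMinimalGradedFreeResolution wB J) :
    ((FA.baseChange (inclA k p q)).tensor
      (FB.baseChange (inclB k p q))).IsMinimalGradedFreeResolution w (sumIdeal I J) := by
  have hT : ((FA.baseChange (inclA k p q)).tensor (FB.baseChange (inclB k p q))).IsMinimalGraded w :=
    (hA.isMinimalGraded.baseChange_rename hwA).tensor (hB.isMinimalGraded.baseChange_rename hwB)
  obtain ⟨εA, hεA, hhA⟩ := hA.exists_isAugmented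
  obtain ⟨εB, hεB, hhB⟩ := hB.exists_isAugmented
  refine .of_isAugmented hT.graded hT.minimal (hεA.tensor hεB) ?_
  intro (x : FA.ι × FB.ι) hx
  have hx : FA.hdeg x.1 + FB.hdeg x.2 = 0 := hx
  obtain ⟨f, hf, hεf⟩ := hhA x.1 (by omega)
  obtain ⟨g, hg, hεg⟩ := hhB x.2 (by omega)
  refine ⟨inclA k p q f * inclB k p q g, (isWeightedHomogeneous_rename hwA hf).mul
    (isWeightedHomogeneous_rename hwB hg), (tensorAug_single εA εB x).trans ?_⟩
  rw [hεf, hεg, quotA_mk, quotB_mk, map_mul]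

/-- The mapping cone of the multiplication by `r` on a minimal graded free resolution of `R/I` is a
minimal graded free resolution of `R/(I + (r))`, if `r` is a homogeneous nonzerodivisor modulo `I`
in the maximal homogeneous ideal. -/
theorem IsMinimalGradedFreeResolution.cone {w : σ → ℕ} {I : Ideal (MvPolynomial σ k)}
    {F : FreeComplex (MvPolynomial σ k)} (hF : F.IsMinimalGradedFreeResolution w I)
    {r : MvPolynomial σ k} {e : ℕ} (hr : MvPolynomial.IsWeightedHomogeneous w r e)
    (hrm : r ∈ Ideal.span (Set.range (MvPolynomial.X (R := k) (σ := σ))))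
    (hreg : ∀ z : MvPolynomial σ k ⧸ I, r • z = 0 → z = 0) :
    (F.cone r e).IsMinimalGradedFreeResolution w (I ⊔ Ideal.span {r}) := by
  have hC := hF.isMinimalGraded.cone hr hrm
  obtain ⟨ε, hε, hh⟩ := hF.exists_isAugmented
  refine .of_isAugmented hC.graded hC.minimal (hε.cone r e hreg) ?_
  rintro (j | j) hj
  · obtain ⟨f, hf, hεf⟩ := hh j hj
    refine ⟨f, hf, (Finsupp.linearCombination_single _ _ _).trans ?_⟩
    rw [one_smul, Sum.elim_inl, hεf]
    rfl
  · exact absurd hj (Nat.succ_ne_zero _)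

end Graded

/-! ### Betti numbers and the last nonzero module -/

section Betti

variable {k : Type*} [Field k] {σ : Type*}

theorem IsMinimalGradedFreeResolution.constantCoeff_diff {w : σ → ℕ} {I : Ideal (MvPolynomial σ k)}
    {F : FreeComplex (MvPolynomial σ k)} (hF : F.IsMinimalGradedFreeResolution w I) (j i : F.ι) :
    MvPolynomial.constantCoeff (F.diff j i) = 0 := by
  suffices h : Ideal.span (Set.range (MvPolynomial.X (R := k) (σ := σ))) ≤
      RingHom.ker MvPolynomial.constantCoeff from h (hF.minimal j i)
  rw [Ideal.span_le]
  rintro _ ⟨s, rfl⟩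
  simp [RingHom.mem_ker]

/-- The Betti numbers are the ranks of the modules in any minimal graded free resolution. -/
theorem IsMinimalGradedFreeResolution.hasBettiNumbers {w : σ → ℕ} {I : Ideal (MvPolynomial σ k)}
    {F : FreeComplex (MvPolynomial σ k)} (hF : F.IsMinimalGradedFreeResolution w I) :
    HasBettiNumbers w I F.rank := by
  refine ⟨⟨F, hF⟩, fun G hG i => ?_⟩
  obtain ⟨εF, hεF, -⟩ := hF.exists_isAugmented
  obtain ⟨εG, hεG, -⟩ := hG.exists_isAugmented
  rcases lt_or_ge i 0 with hi | hi
  · rw [rank_of_neg _ hi, rank_of_neg _ hi]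
  · obtain ⟨n, rfl⟩ := Int.eq_ofNat_of_zero_le hi
    exact le_antisymm (hεG.rank_le hεF hG.constantCoeff_diff n)
      (hεF.rank_le hεG hF.constantCoeff_diff n)

theorem rank_ne_zero {R : Type*} [CommRing R] {F : FreeComplex R} (j : F.ι) :
    F.rank (F.hdeg j) ≠ 0 := by
  rw [rank_natCast]
  exact Finset.card_ne_zero_of_mem (a := j) (by simp)

theorem rank_eq_zero {R : Type*} [CommRing R] {F : FreeComplex R} {i : ℤ}
    (h : ∀ j, (F.hdeg j : ℤ) ≠ i) : F.rank i = 0 := by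
  rw [rank, Set.eq_empty_of_forall_notMem (s := {j : F.ι | (F.hdeg j : ℤ) = i}) h, Set.ncard_empty]

/-- A minimal graded free resolution over a polynomial ring in finitely many variables has a last
nonzero module. -/
theorem IsMinimalGradedFreeResolution.exists_last {p : ℕ} {w : Fin p → ℕ}
    {I : Ideal (MvPolynomial (Fin p) k)} (hI : I ≠ ⊤) {F : FreeComplex (MvPolynomial (Fin p) k)}
    (hF : F.IsMinimalGradedFreeResolution w I) :
    ∃ r : ℕ, F.rank r ≠ 0 ∧ ∀ i : ℤ, r < i → F.rank i = 0 := by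
  classical
  have hb : ∀ j, F.hdeg j ≤ p := fun j => by
    have := ExactAbove.hdeg_le p (F := F) (N := 0) (fun n _ => hF.exact_pos n)
      hF.constantCoeff_diff j
    omega
  obtain ⟨ε, hε, -⟩ := hF.exists_isAugmented
  have hne : Nonempty F.ι := by
    by_contra h
    rw [not_nonempty_iff] at h
    have := Ideal.Quotient.nontrivial_iff.2 hI
    obtain ⟨x, hx⟩ := hε.surjective 1
    rw [Subsingleton.elim x 0, map_zero] at hx
    exact zero_ne_one hx
  obtain ⟨j⟩ := hne
  -- The syzygy bound `hb` makes the search up to `p` exhaustive, and the basis element `j` shows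
  -- that it succeeds.
  refine ⟨Nat.findGreatest (fun n => F.rank n ≠ 0) p,
    Nat.findGreatest_spec (P := fun n : ℕ => F.rank n ≠ 0) (hb j) (rank_ne_zero j),
    fun i hi => rank_eq_zero fun l hl => ?_⟩
  subst hl
  exact Nat.findGreatest_is_greatest (P := fun n : ℕ => F.rank n ≠ 0) (by exact_mod_cast hi) (hb l)
    (rank_ne_zero l)

end Betti

/-! ### Ranks of cones and tensor products -/

section Rank

variable {R : Type*} [CommRing R]

theorem finite_hdeg_int (F : FreeComplex R) (i : ℤ) : {j : F.ι | (F.hdeg j : ℤ) = i}.Finite :=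
  (F.finite_hdeg i.toNat).subset fun j hj => by
    have hj : (F.hdeg j : ℤ) = i := hj
    change F.hdeg j = i.toNat
    omega

theorem rank_cone (F : FreeComplex R) (r : R) (e : ℕ) (i : ℤ) :
    (F.cone r e).rank i = F.rank i + F.rank (i - 1) := by
  have h : {x : F.ι ⊕ F.ι | ((F.cone r e).hdeg x : ℤ) = i} =
      Sum.inl '' {j | (F.hdeg j : ℤ) = i} ∪ Sum.inr '' {j | (F.hdeg j : ℤ) = i - 1} := by
    ext (j | j)
    · simp [FreeComplex.cone]
    · simp [FreeComplex.cone, eq_sub_iff_add_eq]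
  refine (congrArg Set.ncard h).trans ?_
  rw [Set.ncard_union_eq ?_ ((F.finite_hdeg_int _).image _) ((F.finite_hdeg_int _).image _),
    Set.ncard_image_of_injective _ Sum.inl_injective,
    Set.ncard_image_of_injective _ Sum.inr_injective]
  · rfl
  · rw [Set.disjoint_left]
    rintro _ ⟨j, -, rfl⟩ ⟨l, -, h⟩
    simp at h

/-- Terms with `m > i` vanish because ranks in negative degrees are zero. The freedom in `N` lets
the sums for `i` and `i - 1` run over the same range in `rank_cone_tensor`. -/
theorem rank_tensor (F G : FreeComplex R) (i : ℤ) (N : ℕ) (hN : i < N) :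
    (F.tensor G).rank i = ∑ m ∈ Finset.range N, F.rank m * G.rank (i - m) := by
  classical
  let A : ℤ → Finset F.ι := fun z => (F.finite_hdeg_int z).toFinset
  let B : ℤ → Finset G.ι := fun z => (G.finite_hdeg_int z).toFinset
  have hA : ∀ z, F.rank z = (A z).card := fun z => Set.ncard_eq_toFinset_card _ _
  have hB : ∀ z, G.rank z = (B z).card := fun z => Set.ncard_eq_toFinset_card _ _
  have h : {x : F.ι × G.ι | ((F.tensor G).hdeg x : ℤ) = i} =
      ((Finset.range N).biUnion fun m => A m ×ˢ B (i - m) : Finset (F.ι × G.ι)) := by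
    ext ⟨j, l⟩
    have h1 : ((F.tensor G).hdeg (j, l) : ℤ) = F.hdeg j + G.hdeg l := Nat.cast_add _ _
    simp only [Set.mem_ofPred_eq, h1, Finset.coe_biUnion, Set.mem_iUnion, Finset.mem_coe,
      Finset.mem_range, Finset.mem_product, A, B, Set.Finite.mem_toFinset, Nat.cast_inj]
    constructor
    · intro h
      exact ⟨F.hdeg j, by omega, rfl, by omega⟩
    · rintro ⟨m, -, rfl, h⟩
      omega
  refine (congrArg Set.ncard h).trans ?_
  rw [Set.ncard_coe_finset, Finset.card_biUnion]
  · simp only [Finset.card_product, hA, hB]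
  · intro m _ m' _ hne
    refine Finset.disjoint_left.2 ?_
    rintro ⟨j, l⟩ h1 h2
    simp only [Finset.mem_product, A, Set.Finite.mem_toFinset, Set.mem_ofPred_eq] at h1 h2
    omega

theorem rank_tensor_comm (F G : FreeComplex R) (i : ℤ) :
    (F.tensor G).rank i = (G.tensor F).rank i := by
  have h : {x : G.ι × F.ι | ((G.tensor F).hdeg x : ℤ) = i} =
      Prod.swap '' {x : F.ι × G.ι | ((F.tensor G).hdeg x : ℤ) = i} := by
    ext ⟨j, l⟩
    simp [FreeComplex.tensor, add_comm]
  refine ((congrArg Set.ncard h).trans ?_).symm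
  exact Set.ncard_image_of_injective _ Prod.swap_injective

theorem rank_cone_tensor (F G : FreeComplex R) (r : R) (e : ℕ) (i : ℕ) :
    ((F.tensor G).cone r e).rank i =
      ∑ m ∈ Finset.range (i + 1), F.rank m * (G.rank (i - m) + G.rank (i - m - 1)) := by
  rw [rank_cone, rank_tensor F G i (i + 1) (by push_cast; omega),
    rank_tensor F G (i - 1) (i + 1) (by push_cast; omega), ← Finset.sum_add_distrib]
  refine Finset.sum_congr rfl fun m _ => ?_
  rw [mul_add, sub_right_comm]

/-- The last nonzero ranks multiply. -/
theorem rank_cone_tensor_last (F G : FreeComplex R) (r : R) (e : ℕ) {a b : ℕ}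
    (ha : ∀ i : ℤ, a < i → F.rank i = 0) (hb : ∀ i : ℤ, b < i → G.rank i = 0) :
    ((F.tensor G).cone r e).rank (a + b + 1 : ℕ) = F.rank a * G.rank b ∧
      ∀ i : ℤ, (a + b + 1 : ℕ) < i → ((F.tensor G).cone r e).rank i = 0 := by
  constructor
  -- At `m = a` the bracket is the sum of the ranks of `G` in degrees `b + 1` and `b`, of which only
  -- the second survives. For `m < a` both degrees exceed `b`, and for `m > a` the rank of `F` is
  -- zero.
  · rw [rank_cone_tensor, Finset.sum_eq_single a]
    · rw [hb _ (by push_cast; omega), zero_add]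
      congr 2
      push_cast
      ring
    · intro m hm hne
      rcases lt_or_gt_of_ne hne with h | h
      · rw [hb _ (by push_cast; omega), hb _ (by push_cast; omega), add_zero, mul_zero]
      · rw [ha _ (by exact_mod_cast h), zero_mul]
    · intro h
      exact absurd (Finset.mem_range.2 (by omega)) h
  · intro i hi
    obtain ⟨n, rfl⟩ := Int.eq_ofNat_of_zero_le (show 0 ≤ i by omega)
    rw [rank_cone_tensor]
    refine Finset.sum_eq_zero fun m _ => ?_
    rcases lt_or_ge a m with h | h
    · rw [ha _ (by exact_mod_cast h), zero_mul]
    · rw [hb _ (by push_cast at hi; omega), hb _ (by push_cast at hi; omega), add_zero, mul_zero]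

end Rank

end FreeComplex

end

/-! ### Semigroup ideals and the gluing binomial -/

noncomputable section

section Semigroup

variable {k : Type*} [Field k] {n p q : ℕ} {σ : Type*}

/-- The element of `ℕⁿ` which is the exponent of the image of the monomial `x ^ u`. -/
def exponent (c : σ → Fin n →₀ ℕ) : (σ →₀ ℕ) →+ (Fin n →₀ ℕ) :=
  Finsupp.liftAddHom fun s => (multiplesHom _ (c s))

theorem exponent_single (c : σ → Fin n →₀ ℕ) (s : σ) (m : ℕ) :
    exponent c (Finsupp.single s m) = m • c s := by
  simp [exponent]

theorem aeval_monomial_eq (c : σ → Fin n →₀ ℕ) (u : σ →₀ ℕ) :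
    MvPolynomial.aeval (fun s => MvPolynomial.monomial (c s) (1 : k))
        (MvPolynomial.monomial u (1 : k)) =
      MvPolynomial.monomial (exponent c u) (1 : k) := by
  induction u using Finsupp.induction_linear with
  | zero =>
    rw [map_zero]
    exact map_one _
  | add u v hu hv =>
    have h : MvPolynomial.monomial (u + v) (1 : k) =
        MvPolynomial.monomial u 1 * MvPolynomial.monomial v 1 := by
      rw [MvPolynomial.monomial_mul, one_mul]
    rw [h, map_mul, hu, hv, map_add, MvPolynomial.monomial_mul, one_mul]
  | single s m =>
    rw [← MvPolynomial.X_pow_eq_monomial, map_pow, MvPolynomial.aeval_X, exponent_single,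
      MvPolynomial.monomial_pow, one_pow]

/-- In `ℕⁿ` a sum is zero only if every summand is zero. -/
theorem exponent_eq_zero {c : σ → Fin n →₀ ℕ} (hc : ∀ s, c s ≠ 0) {u : σ →₀ ℕ}
    (hu : exponent c u = 0) : u = 0 := by
  by_contra hne
  obtain ⟨s, hs⟩ := Finsupp.ne_iff.1 hne
  have h : exponent c (Finsupp.single s 1) + exponent c (u - Finsupp.single s 1) = 0 := by
    rw [← map_add, add_tsub_cancel_of_le, hu]
    rw [Finsupp.single_le_iff]
    exact Nat.one_le_iff_ne_zero.2 hs
  rw [exponent_single, one_smul] at h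
  exact hc s (add_eq_zero.1 h).1

/-- The weight grading is a coarsening of the grading by `ℕⁿ`, so monomials with equal exponents in
`ℕⁿ` have equal weights. -/
theorem weight_semigroupWeight (c : σ → Fin n →₀ ℕ) (u : σ →₀ ℕ) :
    Finsupp.weight (semigroupWeight c) u = (exponent c u).degree := by
  induction u using Finsupp.induction_linear with
  | zero => simp
  | add u v hu hv => simp only [map_add, hu, hv]
  | single s m =>
    rw [exponent_single, Finsupp.weight_single, map_nsmul]
    rfl

theorem monomial_sub_monomial_mem {c : σ → Fin n →₀ ℕ} {u v : σ →₀ ℕ} :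
    MvPolynomial.monomial u 1 - MvPolynomial.monomial v 1 ∈ semigroupIdeal k c ↔
      exponent c u = exponent c v := by
  rw [semigroupIdeal, RingHom.mem_ker, map_sub, aeval_monomial_eq, aeval_monomial_eq, sub_eq_zero]
  exact MvPolynomial.monomial_left_inj one_ne_zero

theorem semigroupIdeal_ne_top (c : σ → Fin n →₀ ℕ) : semigroupIdeal k c ≠ ⊤ :=
  RingHom.ker_ne_top _

variable (k) in
/-- The map `k[x, y] → k[t, t']` which defines the semigroup ring of the direct sum of two
semigroups. -/
def directSumMap (a : Fin p → Fin n →₀ ℕ) (b : Fin q → Fin n →₀ ℕ) :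
    MvPolynomial (Fin p ⊕ Fin q) k →ₐ[k] MvPolynomial (Fin n ⊕ Fin n) k :=
  MvPolynomial.aeval (Sum.elim
    (fun i => MvPolynomial.rename Sum.inl (MvPolynomial.monomial (a i) 1))
    fun j => MvPolynomial.rename Sum.inr (MvPolynomial.monomial (b j) 1))

theorem directSumMap_inclA (a : Fin p → Fin n →₀ ℕ) (b : Fin q → Fin n →₀ ℕ)
    (f : MvPolynomial (Fin p) k) : directSumMap k a b (inclA k p q f) =
      MvPolynomial.rename Sum.inl
        (MvPolynomial.aeval (fun i => MvPolynomial.monomial (a i) (1 : k)) f) := by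
  have : (directSumMap k a b).comp (MvPolynomial.rename Sum.inl) =
      (MvPolynomial.rename Sum.inl).comp
        (MvPolynomial.aeval (fun i => MvPolynomial.monomial (a i) (1 : k))) := by
    refine MvPolynomial.algHom_ext fun i => ?_
    simp only [directSumMap, AlgHom.comp_apply, MvPolynomial.rename_X, MvPolynomial.aeval_X,
      Sum.elim_inl]
  exact DFunLike.congr_fun this f

theorem directSumMap_inclB (a : Fin p → Fin n →₀ ℕ) (b : Fin q → Fin n →₀ ℕ)
    (f : MvPolynomial (Fin q) k) : directSumMap k a b (inclB k p q f) =
      MvPolynomial.rename Sum.inr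
        (MvPolynomial.aeval (fun i => MvPolynomial.monomial (b i) (1 : k)) f) := by
  have : (directSumMap k a b).comp (MvPolynomial.rename Sum.inr) =
      (MvPolynomial.rename Sum.inr).comp
        (MvPolynomial.aeval (fun i => MvPolynomial.monomial (b i) (1 : k))) := by
    refine MvPolynomial.algHom_ext fun i => ?_
    simp only [directSumMap, AlgHom.comp_apply, MvPolynomial.rename_X, MvPolynomial.aeval_X,
      Sum.elim_inr]
  exact DFunLike.congr_fun this f

theorem mapDomain_inl_add_inr_injective {ι κ : Type*} {u u' : ι →₀ ℕ} {v v' : κ →₀ ℕ}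
    (h : Finsupp.mapDomain Sum.inl u + Finsupp.mapDomain Sum.inr v =
      Finsupp.mapDomain Sum.inl u' + Finsupp.mapDomain Sum.inr v') : u = u' ∧ v = v' := by
  have h1 : ∀ (w : κ →₀ ℕ) (i : ι),
      Finsupp.mapDomain (Sum.inr : κ → ι ⊕ κ) w (Sum.inl i) = 0 := fun w i =>
    Finsupp.mapDomain_of_notMem_range w _ (by simp)
  have h2 : ∀ (w : ι →₀ ℕ) (i : κ),
      Finsupp.mapDomain (Sum.inl : ι → ι ⊕ κ) w (Sum.inr i) = 0 := fun w i =>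
    Finsupp.mapDomain_of_notMem_range w _ (by simp)
  constructor
  · ext i
    have := DFunLike.congr_fun h (Sum.inl i)
    simpa only [Finsupp.add_apply, h1, add_zero, Finsupp.mapDomain_apply Sum.inl_injective] using
      this
  · ext i
    have := DFunLike.congr_fun h (Sum.inr i)
    simpa only [Finsupp.add_apply, h2, zero_add, Finsupp.mapDomain_apply Sum.inr_injective] using
      this

theorem exists_eq_mapDomain_add {ι κ : Type*} (u : ι ⊕ κ →₀ ℕ) :
    ∃ (v : ι →₀ ℕ) (w : κ →₀ ℕ), u = Finsupp.mapDomain Sum.inl v + Finsupp.mapDomain Sum.inr w := by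
  induction u using Finsupp.induction_linear with
  | zero => exact ⟨0, 0, by simp⟩
  | add u u' hu hu' =>
    obtain ⟨v, w, rfl⟩ := hu
    obtain ⟨v', w', rfl⟩ := hu'
    refine ⟨v + v', w + w', ?_⟩
    rw [Finsupp.mapDomain_add, Finsupp.mapDomain_add, add_add_add_comm]
  | single s m =>
    rcases s with s | s
    · exact ⟨Finsupp.single s m, 0, by simp⟩
    · exact ⟨0, Finsupp.single s m, by simp⟩

theorem monomial_eq_inclA_mul_inclB (v : Fin p →₀ ℕ) (w : Fin q →₀ ℕ) :
    MvPolynomial.monomial (Finsupp.mapDomain Sum.inl v + Finsupp.mapDomain Sum.inr w) (1 : k) =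
      inclA k p q (MvPolynomial.monomial v 1) * inclB k p q (MvPolynomial.monomial w 1) := by
  change _ = MvPolynomial.rename Sum.inl _ * MvPolynomial.rename Sum.inr _
  rw [MvPolynomial.rename_monomial, MvPolynomial.rename_monomial, MvPolynomial.monomial_mul,
    one_mul]

open FreeComplex

/-- The ideal `I_A R + I_B R` is the ideal of the direct sum of the two semigroups. -/
theorem mem_sumIdeal_semigroupIdeal (a : Fin p → Fin n →₀ ℕ) (b : Fin q → Fin n →₀ ℕ)
    (f : MvPolynomial (Fin p ⊕ Fin q) k) :
    f ∈ sumIdeal (semigroupIdeal k a) (semigroupIdeal k b) ↔ directSumMap k a b f = 0 := by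
  constructor
  · intro hf
    suffices h : sumIdeal (semigroupIdeal k a) (semigroupIdeal k b) ≤
      RingHom.ker (directSumMap k a b) from h hf
    refine sup_le (Ideal.map_le_iff_le_comap.2 fun g hg => ?_)
      (Ideal.map_le_iff_le_comap.2 fun g hg => ?_)
    · rw [Ideal.mem_comap, RingHom.mem_ker, directSumMap_inclA, RingHom.mem_ker.1 hg, map_zero]
    · rw [Ideal.mem_comap, RingHom.mem_ker, directSumMap_inclB, RingHom.mem_ker.1 hg, map_zero]
  · intro hf
    set J := sumIdeal (semigroupIdeal k a) (semigroupIdeal k b) with hJ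
    let D : (Fin p →₀ ℕ) × (Fin q →₀ ℕ) → (Fin n ⊕ Fin n →₀ ℕ) := fun u =>
      Finsupp.mapDomain Sum.inl (exponent a u.1) + Finsupp.mapDomain Sum.inr (exponent b u.2)
    let G : (Fin p →₀ ℕ) × (Fin q →₀ ℕ) → MvPolynomial (Fin p ⊕ Fin q) k ⧸ J := fun u =>
      Ideal.Quotient.mk J
        (inclA k p q (MvPolynomial.monomial u.1 1) * inclB k p q (MvPolynomial.monomial u.2 1))
    -- `D u` is the exponent of the image of a monomial and `G u` its class modulo `J`. If two
    -- monomials have the same image, their `x`-parts differ by a binomial of `I_A` and their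
    -- `y`-parts by one of `I_B`, so their classes agree.
    have hGD : G.FactorsThrough D := by
      rintro ⟨u, v⟩ ⟨u', v'⟩ h
      obtain ⟨h1, h2⟩ := mapDomain_inl_add_inr_injective h
      have e1 : Ideal.Quotient.mk J (inclA k p q (MvPolynomial.monomial u 1)) =
          Ideal.Quotient.mk J (inclA k p q (MvPolynomial.monomial u' 1)) := by
        rw [Ideal.Quotient.eq, ← map_sub]
        exact Ideal.mem_sup_left (Ideal.mem_map_of_mem _ (monomial_sub_monomial_mem.2 h1))
      have e2 : Ideal.Quotient.mk J (inclB k p q (MvPolynomial.monomial v 1)) =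
          Ideal.Quotient.mk J (inclB k p q (MvPolynomial.monomial v' 1)) := by
        rw [Ideal.Quotient.eq, ← map_sub]
        exact Ideal.mem_sup_right (Ideal.mem_map_of_mem _ (monomial_sub_monomial_mem.2 h2))
      simp only [G, map_mul, e1, e2]
    -- A `k`-linear map through which the quotient map factors after `directSumMap`. Exponents
    -- outside the image of `D` get the default value `0`, which is never consulted.
    let θ : MvPolynomial (Fin n ⊕ Fin n) k →ₗ[k] MvPolynomial (Fin p ⊕ Fin q) k ⧸ J :=
      (MvPolynomial.basisMonomials (Fin n ⊕ Fin n) k).constr k (Function.extend D G 0)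
    have hθ : ∀ u, θ (MvPolynomial.monomial (D u) 1) = G u := fun u => by
      have := (MvPolynomial.basisMonomials (Fin n ⊕ Fin n) k).constr_basis k
        (Function.extend D G 0) (D u)
      rw [MvPolynomial.coe_basisMonomials] at this
      rw [this, hGD.extend_apply]
    have key : θ ∘ₗ (directSumMap k a b).toLinearMap = (Ideal.Quotient.mkₐ k J).toLinearMap := by
      refine (MvPolynomial.basisMonomials (Fin p ⊕ Fin q) k).ext fun u => ?_
      obtain ⟨v, w, rfl⟩ := exists_eq_mapDomain_add u
      rw [MvPolynomial.coe_basisMonomials]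
      beta_reduce
      rw [monomial_eq_inclA_mul_inclB, LinearMap.comp_apply,
        AlgHom.toLinearMap_apply, map_mul, directSumMap_inclA, directSumMap_inclB,
        aeval_monomial_eq, aeval_monomial_eq, MvPolynomial.rename_monomial,
        MvPolynomial.rename_monomial, MvPolynomial.monomial_mul, one_mul]
      exact hθ (v, w)
    have h := LinearMap.congr_fun key f
    rw [LinearMap.comp_apply, AlgHom.toLinearMap_apply, hf, map_zero] at h
    exact Ideal.Quotient.eq_zero_iff_mem.1 h.symm

theorem directSumMap_gluingBinomial (a : Fin p → Fin n →₀ ℕ) (b : Fin q → Fin n →₀ ℕ)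
    (α : Fin p →₀ ℕ) (β : Fin q →₀ ℕ) :
    directSumMap k a b (gluingBinomial k α β) =
      MvPolynomial.monomial (Finsupp.mapDomain Sum.inl (exponent a α)) 1 -
        MvPolynomial.monomial (Finsupp.mapDomain Sum.inr (exponent b β)) 1 := by
  rw [gluingBinomial, map_sub, directSumMap_inclA, directSumMap_inclB, aeval_monomial_eq,
    aeval_monomial_eq, MvPolynomial.rename_monomial, MvPolynomial.rename_monomial]

/-- The gluing binomial is a nonzerodivisor modulo `I_A R + I_B R`. -/
theorem gluingBinomial_regular {a : Fin p → Fin n →₀ ℕ} (ha : ∀ i, a i ≠ 0)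
    (b : Fin q → Fin n →₀ ℕ) {α : Fin p →₀ ℕ} (hα : α ≠ 0) (β : Fin q →₀ ℕ)
    (z : MvPolynomial (Fin p ⊕ Fin q) k ⧸ sumIdeal (semigroupIdeal k a) (semigroupIdeal k b))
    (hz : gluingBinomial k α β • z = 0) : z = 0 := by
  obtain ⟨f, rfl⟩ := Ideal.Quotient.mk_surjective z
  have h : gluingBinomial k α β * f ∈ sumIdeal (semigroupIdeal k a) (semigroupIdeal k b) :=
    Ideal.Quotient.eq_zero_iff_mem.1 hz
  rw [mem_sumIdeal_semigroupIdeal, map_mul, directSumMap_gluingBinomial] at h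
  rw [Ideal.Quotient.eq_zero_iff_mem, mem_sumIdeal_semigroupIdeal]
  -- The polynomial ring in `t, t'` is a domain. The two monomials in the image of `ρ` involve
  -- disjoint variables, so if they were equal, both would be `1` and `α` would vanish.
  refine (mul_eq_zero.1 h).resolve_left fun h0 => ?_
  have h1 := (MvPolynomial.monomial_left_inj (one_ne_zero (α := k))).1 (sub_eq_zero.1 h0)
  have h2 := mapDomain_inl_add_inr_injective (u := exponent a α) (v := 0) (u' := 0)
    (v' := exponent b β) (by simpa using h1)
  exact hα (exponent_eq_zero ha h2.1)

theorem gluingBinomial_mem_semigroupIdeal {a : Fin p → Fin n →₀ ℕ} {b : Fin q → Fin n →₀ ℕ}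
    {α : Fin p →₀ ℕ} {β : Fin q →₀ ℕ}
    (h : gluingBinomial k α β ∈ semigroupIdeal k (Sum.elim a b)) :
    exponent a α = exponent b β := by
  have hA : exponent (Sum.elim a b) (Finsupp.mapDomain Sum.inl α) = exponent a α := by
    clear h
    induction α using Finsupp.induction_linear with
    | zero => simp
    | add u v hu hv => rw [Finsupp.mapDomain_add, map_add, map_add, hu, hv]
    | single s m => rw [Finsupp.mapDomain_single, exponent_single, exponent_single, Sum.elim_inl]
  have hB : exponent (Sum.elim a b) (Finsupp.mapDomain Sum.inr β) = exponent b β := by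
    clear h
    induction β using Finsupp.induction_linear with
    | zero => simp
    | add u v hu hv => rw [Finsupp.mapDomain_add, map_add, map_add, hu, hv]
    | single s m => rw [Finsupp.mapDomain_single, exponent_single, exponent_single, Sum.elim_inr]
  rw [← hA, ← hB, ← monomial_sub_monomial_mem (k := k), ← MvPolynomial.rename_monomial,
    ← MvPolynomial.rename_monomial]
  exact h

theorem IsGluing.sumIdeal_sup_span {a : Fin p → Fin n →₀ ℕ} {b : Fin q → Fin n →₀ ℕ}
    {α : Fin p →₀ ℕ} {β : Fin q →₀ ℕ} (h : IsGluing k a b α β) :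
    sumIdeal (semigroupIdeal k a) (semigroupIdeal k b) ⊔ Ideal.span {gluingBinomial k α β} =
      semigroupIdeal k (Sum.elim a b) := by
  obtain ⟨S, T, ⟨hS, -⟩, ⟨hT, -⟩, hU, -⟩ := h
  rw [← hU, ← hS, ← hT, Ideal.span_union, Ideal.span_union, sumIdeal, Ideal.map_span,
    Ideal.map_span]

theorem IsGluing.exponent_eq {a : Fin p → Fin n →₀ ℕ} {b : Fin q → Fin n →₀ ℕ}
    {α : Fin p →₀ ℕ} {β : Fin q →₀ ℕ} (h : IsGluing k a b α β) : exponent a α = exponent b β := by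
  refine gluingBinomial_mem_semigroupIdeal (k := k) ?_
  rw [← h.sumIdeal_sup_span]
  exact Ideal.mem_sup_right (Ideal.mem_span_singleton_self _)

/-- A zero generator could be removed, against the minimality of the generating set of `I_C`. -/
theorem IsGluing.gluingBinomial_ne_zero {a : Fin p → Fin n →₀ ℕ} {b : Fin q → Fin n →₀ ℕ}
    {α : Fin p →₀ ℕ} {β : Fin q →₀ ℕ} (h : IsGluing k a b α β) : gluingBinomial k α β ≠ 0 := by
  obtain ⟨S, T, -, -, hU, hmin⟩ := h
  intro h0
  rw [h0] at hU hmin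
  refine hmin (_ \ {0}) ?_ ((Submodule.span_sdiff_singleton_zero).trans hU)
  exact Set.sdiff_singleton_ssubset.2 (by simp)

/-- The exponents of `x^α` and `y^β` in `ℕⁿ` agree, so `α` and `β` vanish together; if they did, `ρ`
would be `1 - 1 = 0`. -/
theorem IsGluing.ne_zero {a : Fin p → Fin n →₀ ℕ} {b : Fin q → Fin n →₀ ℕ}
    (ha : ∀ i, a i ≠ 0) (hb : ∀ j, b j ≠ 0) {α : Fin p →₀ ℕ} {β : Fin q →₀ ℕ}
    (h : IsGluing k a b α β) : α ≠ 0 ∧ β ≠ 0 := by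
  have h1 : α = 0 ↔ β = 0 := by
    constructor
    · rintro rfl
      exact exponent_eq_zero hb (by rw [← h.exponent_eq, map_zero])
    · rintro rfl
      exact exponent_eq_zero ha (by rw [h.exponent_eq, map_zero])
  have h2 : α ≠ 0 := by
    intro h0
    apply h.gluingBinomial_ne_zero
    rw [h0, h1.1 h0, gluingBinomial]
    change inclA k p q 1 - inclB k p q 1 = 0
    rw [map_one, map_one, sub_self]
  exact ⟨h2, fun h0 => h2 (h1.2 h0)⟩

theorem IsGluing.isWeightedHomogeneous {a : Fin p → Fin n →₀ ℕ} {b : Fin q → Fin n →₀ ℕ}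
    {α : Fin p →₀ ℕ} {β : Fin q →₀ ℕ} (h : IsGluing k a b α β) :
    MvPolynomial.IsWeightedHomogeneous (semigroupWeight (Sum.elim a b)) (gluingBinomial k α β)
      (Finsupp.weight (semigroupWeight a) α) := by
  have hw : Finsupp.weight (semigroupWeight a) α = Finsupp.weight (semigroupWeight b) β := by
    rw [weight_semigroupWeight, weight_semigroupWeight, h.exponent_eq]
  rw [gluingBinomial, sub_eq_add_neg]
  refine MvPolynomial.IsWeightedHomogeneous.add ?_ (isWeightedHomogeneous_neg ?_)
  · exact isWeightedHomogeneous_rename (fun _ => rfl)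
      (MvPolynomial.isWeightedHomogeneous_monomial _ _ _ rfl)
  · rw [hw]
    exact isWeightedHomogeneous_rename (fun _ => rfl)
      (MvPolynomial.isWeightedHomogeneous_monomial _ _ _ rfl)

theorem monomial_mem_span_X {u : σ →₀ ℕ} (hu : u ≠ 0) :
    MvPolynomial.monomial u (1 : k) ∈ Ideal.span (Set.range (MvPolynomial.X (R := k) (σ := σ))) := by
  obtain ⟨s, hs⟩ := Finsupp.ne_iff.1 hu
  have h : MvPolynomial.X s ∣ MvPolynomial.monomial u (1 : k) :=
    MvPolynomial.X_dvd_monomial.2 (Or.inr hs)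
  exact Ideal.mem_of_dvd _ h (Ideal.subset_span ⟨s, rfl⟩)

theorem gluingBinomial_mem_span_X {α : Fin p →₀ ℕ} {β : Fin q →₀ ℕ} (hα : α ≠ 0) (hβ : β ≠ 0) :
    gluingBinomial k α β ∈
      Ideal.span (Set.range (MvPolynomial.X (R := k) (σ := Fin p ⊕ Fin q))) := by
  refine sub_mem ?_ ?_
  · change MvPolynomial.rename Sum.inl _ ∈ _
    rw [MvPolynomial.rename_monomial]
    exact monomial_mem_span_X fun h => hα
      (Finsupp.mapDomain_injective Sum.inl_injective (h.trans Finsupp.mapDomain_zero.symm))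
  · change MvPolynomial.rename Sum.inr _ ∈ _
    rw [MvPolynomial.rename_monomial]
    exact monomial_mem_span_X fun h => hβ
      (Finsupp.mapDomain_injective Sum.inr_injective (h.trans Finsupp.mapDomain_zero.symm))

end Semigroup

end

/-! ### The gluing theorem -/

theorem theorem6p1 {k : Type*} [Field k] {n p q : ℕ}
    (a : Fin p → Fin n →₀ ℕ) (b : Fin q → Fin n →₀ ℕ)
    (ha : ∀ i, a i ≠ 0) (hb : ∀ j, b j ≠ 0)
    (α : Fin p →₀ ℕ) (β : Fin q →₀ ℕ) (hglue : IsGluing k a b α β)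
    (FA : FreeComplex (MvPolynomial (Fin p) k)) (FB : FreeComplex (MvPolynomial (Fin q) k))
    (hFA : FA.IsMinimalGradedFreeResolution (semigroupWeight a) (semigroupIdeal k a))
    (hFB : FB.IsMinimalGradedFreeResolution (semigroupWeight b) (semigroupIdeal k b)) :
    -- `F_A ⊗ F_B` is a minimal graded free resolution of `R/(I_A R + I_B R)`
    FreeComplex.IsMinimalGradedFreeResolution (semigroupWeight (Sum.elim a b))
      ((semigroupIdeal k a).map (inclA k p q) ⊔ (semigroupIdeal k b).map (inclB k p q))
      ((FA.baseChange (inclA k p q)).tensor (FB.baseChange (inclB k p q))) ∧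
    -- the mapping cone of `ρ` is a minimal graded free resolution of `k[C] = R/I_C`
    FreeComplex.IsMinimalGradedFreeResolution (semigroupWeight (Sum.elim a b))
      (semigroupIdeal k (Sum.elim a b))
      (((FA.baseChange (inclA k p q)).tensor (FB.baseChange (inclB k p q))).cone
        (gluingBinomial k α β) (Finsupp.weight (semigroupWeight a) α)) ∧
    -- the Betti numbers
    (∃ βA βB βC : ℤ → ℕ,
      HasBettiNumbers (semigroupWeight a) (semigroupIdeal k a) βA ∧
      HasBettiNumbers (semigroupWeight b) (semigroupIdeal k b) βB ∧
      HasBettiNumbers (semigroupWeight (Sum.elim a b)) (semigroupIdeal k (Sum.elim a b)) βC ∧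
      ∀ i : ℕ,
        βC i = ∑ i' ∈ Finset.range (i + 1), βA i' * (βB (i - i') + βB (i - i' - 1)) ∧
        βC i = ∑ i' ∈ Finset.range (i + 1), βB i' * (βA (i - i') + βA (i - i' - 1))) ∧
    -- the Cohen-Macaulay types
    ∃ rA rB : ℕ,
      HasCohenMacaulayType (semigroupWeight a) (semigroupIdeal k a) rA ∧
      HasCohenMacaulayType (semigroupWeight b) (semigroupIdeal k b) rB ∧
      HasCohenMacaulayType (semigroupWeight (Sum.elim a b)) (semigroupIdeal k (Sum.elim a b))
        (rA * rB) := by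
  have hT := hFA.tensor (w := semigroupWeight (Sum.elim a b)) (fun _ => rfl) (fun _ => rfl) hFB
  obtain ⟨hα, hβ⟩ := hglue.ne_zero ha hb
  have hC := hT.cone hglue.isWeightedHomogeneous (gluingBinomial_mem_span_X hα hβ)
    (gluingBinomial_regular ha b hα β)
  rw [hglue.sumIdeal_sup_span] at hC
  refine ⟨hT, hC, ⟨_, _, _, hFA.hasBettiNumbers, hFB.hasBettiNumbers, hC.hasBettiNumbers,
    fun i => ⟨?_, ?_⟩⟩, ?_⟩
  -- Extension of scalars keeps the bases, so the ranks of `FA` and `FB` agree definitionally with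
  -- those over `R`.
  · exact FreeComplex.rank_cone_tensor _ _ _ _ i
  -- The second formula is the first with the factors exchanged. The cone over the swapped product
  -- only serves to count, so its internal shift `0` is arbitrary.
  · rw [FreeComplex.rank_cone, FreeComplex.rank_tensor_comm, FreeComplex.rank_tensor_comm _ _ (_ - 1),
      ← FreeComplex.rank_cone _ (gluingBinomial k α β) 0]
    exact FreeComplex.rank_cone_tensor _ _ _ _ i
  · obtain ⟨ra, hra, hra'⟩ := hFA.exists_last (semigroupIdeal_ne_top a)
    obtain ⟨rb, hrb, hrb'⟩ := hFB.exists_last (semigroupIdeal_ne_top b)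
    obtain ⟨h1, h2⟩ := FreeComplex.rank_cone_tensor_last (FA.baseChange (inclA k p q))
      (FB.baseChange (inclB k p q)) (gluingBinomial k α β)
      (Finsupp.weight (semigroupWeight a) α) hra' hrb'
    exact ⟨FA.rank ra, FB.rank rb, ⟨_, hFA.hasBettiNumbers, ra, rfl, hra, hra'⟩,
      ⟨_, hFB.hasBettiNumbers, rb, rfl, hrb, hrb'⟩,
      ⟨_, hC.hasBettiNumbers, _, h1, mul_ne_zero hra hrb, h2⟩⟩
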